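/- Graphs are simple, undirected and without loops, and "countable" means finite or countably infinite. For a set $\mathcal C$ of finite graphs, a graph $G$ omits $\mathcal C$ (is $\mathcal C$-free) if no subgraph of $G$, induced or not, is isomorphic to a graph in $\mathcal C$. Let $\mathcal G_{\mathcal C}$ be the class of countable graphs omitting $\mathcal C$. A graph $G\in\mathcal G_{\mathcal C}$ is universal if every graph in $\mathcal G_{\mathcal C}$ is isomorphic to an induced subgraph of $G$. It is existentially complete if, for every $H\in\mathcal G_{\mathcal C}$ containing $G$ as an induced subgraph and all finite induced subgraphs $A$ of $G$ and $B$ of $H$ with $A\subseteq B$, there is an isomorphism of $B$ onto an induced subgraph of $G$ which is the identity on $A$. Let $T^*_{\mathcal C}$ be the set of all first-order sentences in the language of graphs that hold in every existentially complete graph in $\mathcal G_{\mathcal C}$. A theory is $\aleph_0$-categorical if it has exactly one countable model up to isomorphism. A set $\mathcal H$ of finite graphs is closed under homomorphic image if every homomorphic image of a graph in $\mathcal H$ contains a subgraph isomorphic to a graph in $\mathcal H$ (where a homomorphic image of a graph $K$ is a loopless graph $D$ admitting a homomorphism $K\to D$ that is surjective on vertices and on edges); in particular this holds if every homomorphic image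 of a graph in $\mathcal H$ is isomorphic to a graph in $\mathcal H$. Theorem 5. Let $\mathcal C$ be a finite set of finite connected graphs such that $T^*_{\mathcal C}$ is $\aleph_0$-categorical, and let $\mathcal H$ be a finite set of finite connected graphs which is closed under homomorphic image. Then $T^*_{\mathcal C\cup\mathcal H}$ is $\aleph_0$-categorical. Moreover, there is a universal graph in $\mathcal G_{\mathcal C\cup\mathcal H}$. -/

import Mathlib

open FirstOrder

namespace ForbiddenGraphs

/-- A finite graph (simple and undirected, hence without loops). -/
structure FinGraph where
  /-- the vertices -/
  V : Type
  [finite : Finite V]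
  /-- the graph on these vertices -/
  graph : SimpleGraph V

/-- `G` omits `C`: no subgraph of `G`, induced or not, is isomorphic to a graph in `C`. -/
def Omits (C : Set FinGraph) {V : Type} (G : SimpleGraph V) : Prop :=
  ∀ K ∈ C, K.graph.Free G

/-- Membership in the class of countable (finite or countably infinite) graphs omitting `C`. -/
def IsCountableFree (C : Set FinGraph) {V : Type} (G : SimpleGraph V) : Prop :=
  Countable V ∧ Omits C G

/-- `G` is universal for `C`: it is a countable graph omitting `C`, and every countable graph
omitting `C` is isomorphic to an induced subgraph of `G`. -/
def IsUniversal (C : Set FinGraph) {V : Type} (G : SimpleGraph V) : Prop :=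
  IsCountableFree C G ∧
    ∀ (W : Type) (G' : SimpleGraph W), IsCountableFree C G' → Nonempty (G' ↪g G)

/-- `G`, identified by `f` with an induced subgraph of `H`, is existentially complete in `H`:
whenever `A ⊆ B` are finite induced subgraphs of `G` and `H` respectively, there is an
isomorphism of `B` onto an induced subgraph of `G` that is the identity on `A`. -/
def IsExistentiallyCompleteIn {V W : Type} {G : SimpleGraph V} {H : SimpleGraph W}
    (f : G ↪g H) : Prop :=
  ∀ (A : Set V) (B : Set W), A.Finite → B.Finite → f '' A ⊆ B →
    ∃ g : H.induce B ↪g G, ∀ a ∈ A, ∀ b : B, f a = (b : W) → g b = a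

/-- Membership in the class of existentially complete countable graphs omitting `C`: `G` is
a countable graph omitting `C` that is existentially complete in each countable graph omitting `C`
which contains it as an induced subgraph. -/
def IsExistentiallyComplete (C : Set FinGraph) {V : Type} (G : SimpleGraph V) : Prop :=
  IsCountableFree C G ∧
    ∀ (W : Type) (H : SimpleGraph W), IsCountableFree C H →
      ∀ f : G ↪g H, IsExistentiallyCompleteIn f

/-- The first-order theory `T*_C` of the class of existentially complete graphs for `C`:
all sentences of the language of graphs that hold in every one of them. -/
def theoryStar (C : Set FinGraph) : Language.graph.Theory :=
  {φ | ∀ (V : Type) (G : SimpleGraph V), IsExistentiallyComplete C G →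
    @Language.Sentence.Realize Language.graph V G.structure φ}

/-- `ℵ₀`-categoricity: the theory has exactly one countable (finite or countably infinite) model,
up to isomorphism. -/
def IsAlephZeroCategorical {L : FirstOrder.Language.{0, 0}} (T : L.Theory) : Prop :=
  (∃ (V : Type) (_ : L.Structure V), Countable V ∧ V ⊨ T) ∧
    ∀ (V W : Type) [L.Structure V] [L.Structure W], Countable V → Countable W →
      V ⊨ T → W ⊨ T → Nonempty (V ≃[L] W)

/-- `D` is a homomorphic image of `G`: some homomorphism from `G` to `D` is onto the vertices
and onto the edges of `D`. -/
def IsHomImage {V W : Type} (G : SimpleGraph V) (D : SimpleGraph W) : Prop :=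
  ∃ f : G →g D, Function.Surjective f ∧
    ∀ u v, D.Adj u v → ∃ x y, G.Adj x y ∧ f x = u ∧ f y = v

/-- `H` is closed under homomorphic image: every homomorphic image of a graph in `H` contains
a graph in `H` as a subgraph. This holds in particular if every homomorphic image of a graph
in `H` is isomorphic to a graph in `H`. -/
def IsHomClosed (H : Set FinGraph) : Prop :=
  ∀ K ∈ H, ∀ D : FinGraph, IsHomImage K.graph D.graph → ∃ K' ∈ H, K'.graph.IsContained D.graph

end ForbiddenGraphs

open ForbiddenGraphs

/-! The proof turns on `HasBoundedClosure`: every tuple lies in a finite set `B`, of size bounded in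
terms of its length, such that two copies of the graph glued freely along `B` still omit `C`.

Categoricity yields this property. By omitting types and an ultraproduct argument in the style of
Ryll-Nardzewski, the unique existentially complete graph realizes finitely many existential types of
each length, and equality of types is conjugacy under automorphisms. So algebraic closures are
finite, with size depending only on the type. By Neumann's lemma, automorphisms fixing a closure
move any finite set outside it off any other finite set, so a forbidden copy in the double would
move injectively into the graph.

The property passes to `C ∪ H` with the same sets `B`. The double of `G` projects homomorphically to
`G`, so a copy in it of a member of `H` projects onto a homomorphic image, which contains a member
of `H` inside `G`.

Conversely, for finite `C`, bounded closure makes the existential type of a tuple depend on finitely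
many bits: the small patterns at an enumeration of its closure. Two closures with the same small
patterns can be amalgamated freely, and existentially complete graphs keep their types in the
amalgam. Finitely many types are isolated, so back and forth applies. It starts at the empty tuple,
since connectedness allows disjoint sums. The same finiteness makes every countable model of the
theory existentially complete, and the unique existentially complete graph is universal. -/

namespace ForbiddenGraphs

/-! ### Patterns and existential types -/

/-- A finite graph with `n` marked vertices. It plays the role of an existential formula in `n`
free variables. -/
structure Pattern (n : ℕ) where
  /-- the number of vertices -/
  size : ℕ
  /-- the graph -/
  graph : SimpleGraph (Fin size)
  /-- the marked vertices -/
  pt : Fin n → Fin size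

instance (n : ℕ) : Countable (Pattern n) := by
  have : Function.Injective (fun P : Pattern n =>
      (⟨P.size, P.graph, P.pt⟩ : Σ m, SimpleGraph (Fin m) × (Fin n → Fin m))) := by
    rintro ⟨m, g, p⟩ ⟨m', g', p'⟩ h
    simp only [Sigma.mk.injEq] at h
    obtain ⟨rfl, h⟩ := h
    simp only [heq_eq_eq, Prod.mk.injEq] at h
    obtain ⟨rfl, rfl⟩ := h
    rfl
  exact this.countable

/-- There are finitely many patterns of bounded size. -/
theorem Pattern.finite_size_le (n k : ℕ) : {P : Pattern n | P.size ≤ k}.Finite := by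
  have h : (Set.range (fun x : Σ m : Fin (k + 1), SimpleGraph (Fin m) × (Fin n → Fin m) =>
      (⟨x.1, x.2.1, x.2.2⟩ : Pattern n))).Finite := Set.finite_range _
  refine h.subset ?_
  rintro ⟨m, g, p⟩ hm
  exact ⟨⟨⟨m, Nat.lt_succ_of_le hm⟩, g, p⟩, rfl⟩

/-- The pattern `P` is realized in `G` as an induced subgraph with marked vertices `a`. -/
def Pattern.Holds {n : ℕ} (P : Pattern n) {V : Type*} (G : SimpleGraph V) (a : Fin n → V) : Prop :=
  ∃ g : P.graph ↪g G, ∀ i, g (P.pt i) = a i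

/-- The existential type of a tuple. -/
def exType {n : ℕ} {V : Type*} (G : SimpleGraph V) (a : Fin n → V) : Set (Pattern n) :=
  {P | P.Holds G a}

theorem Pattern.Holds.map {n : ℕ} {P : Pattern n} {V W : Type*} {G : SimpleGraph V}
    {H : SimpleGraph W} {a : Fin n → V} (h : P.Holds G a) (f : G ↪g H) : P.Holds H (f ∘ a) := by
  obtain ⟨g, hg⟩ := h
  exact ⟨f.comp g, fun i => by simp [hg]⟩

theorem exType_map_iso {n : ℕ} {V W : Type*} {G : SimpleGraph V} {H : SimpleGraph W}
    (f : G ≃g H) (a : Fin n → V) : exType H (f ∘ a) = exType G a := by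
  ext P
  refine ⟨fun h => ?_, fun h => h.map f.toEmbedding⟩
  have := Pattern.Holds.map h f.symm.toEmbedding
  have e : (f.symm.toEmbedding : W → V) ∘ (f ∘ a) = a := by ext i; simp
  rwa [e] at this

theorem exists_pattern_of_finite {n : ℕ} {D : Type*} [Finite D] (B : SimpleGraph D)
    (pt : Fin n → D) : ∃ P : Pattern n, P.size = Nat.card D ∧
      ∀ (W : Type) (H : SimpleGraph W) (b : Fin n → W),
        P.Holds H b ↔ ∃ g : B ↪g H, ∀ i, g (pt i) = b i := by
  let e := Finite.equivFin D
  let φ : B ≃g B.map e.toEmbedding := SimpleGraph.Iso.map e B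
  refine ⟨⟨Nat.card D, B.map e.toEmbedding, e ∘ pt⟩, rfl, fun W H b => ⟨?_, ?_⟩⟩
  · rintro ⟨g, hg⟩
    exact ⟨g.comp φ.toEmbedding, fun i => hg i⟩
  · rintro ⟨g, hg⟩
    refine ⟨g.comp φ.symm.toEmbedding, fun i => ?_⟩
    rw [← hg i]
    change g (φ.symm (φ (pt i))) = _
    simp

/-- The pattern given by the induced subgraph on a finite set containing the tuple. -/
theorem exists_pattern_of_set {n : ℕ} {V : Type} (G : SimpleGraph V) (a : Fin n → V) {S : Set V}
    (hS : S.Finite) (haS : ∀ i, a i ∈ S) : ∃ P : Pattern n, P.size = S.ncard ∧ P.Holds G a ∧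
      ∀ (W : Type) (H : SimpleGraph W) (b : Fin n → W),
        P.Holds H b ↔ ∃ g : G.induce S ↪g H, ∀ i, g ⟨a i, haS i⟩ = b i := by
  have := hS.to_subtype
  obtain ⟨P, hP, h⟩ := exists_pattern_of_finite (G.induce S) (fun i => (⟨a i, haS i⟩ : S))
  refine ⟨P, hP, (h V G a).2 ⟨SimpleGraph.Embedding.induce S, fun i => rfl⟩, h⟩

/-- An embedding into `H` whose range lies in `T`, as an embedding into the induced subgraph. -/
def codEmbedding {V W : Type*} {G : SimpleGraph V} {H : SimpleGraph W} (f : G ↪g H)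
    {T : Set W} (h : ∀ x, f x ∈ T) : G ↪g H.induce T where
  toFun x := ⟨f x, h x⟩
  inj' _ _ hxy := f.injective (congrArg Subtype.val hxy)
  map_rel_iff' := f.map_adj_iff

/-- Finitely many patterns that hold at a tuple are implied by a single one. -/
theorem exists_pattern_imp {n : ℕ} {V : Type} (G : SimpleGraph V) (a : Fin n → V)
    {F : Set (Pattern n)} (hF : F.Finite) (h : ∀ P ∈ F, P.Holds G a) :
    ∃ Q : Pattern n, Q.Holds G a ∧ ∀ (W : Type) (H : SimpleGraph W) (b : Fin n → W),
      Q.Holds H b → ∀ P ∈ F, P.Holds H b := by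
  choose g hg using h
  let S : Set V := Set.range a ∪ ⋃ P ∈ F, {x | ∃ hP : P ∈ F, x ∈ Set.range (g P hP)}
  have hS : S.Finite := by
    refine (Set.finite_range a).union (hF.biUnion fun P hP => ?_)
    refine (Set.finite_range (g P hP)).subset ?_
    rintro x ⟨_, hx⟩
    exact hx
  obtain ⟨Q, -, hQ, hQ'⟩ := exists_pattern_of_set G a hS (fun i => Or.inl ⟨i, rfl⟩)
  refine ⟨Q, hQ, fun W H b hb P hP => ?_⟩
  obtain ⟨e, he⟩ := (hQ' W H b).1 hb
  refine ⟨e.comp (codEmbedding (g P hP) fun x => Or.inr ?_), fun i => ?_⟩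
  · exact Set.mem_biUnion hP ⟨hP, x, rfl⟩
  · rw [← he i]
    change e _ = e _
    congr 1
    exact Subtype.ext (hg P hP i)

theorem Omits.of_embedding {C : Set FinGraph} {V W : Type} {G : SimpleGraph V} {H : SimpleGraph W}
    (h : Omits C H) (f : G ↪g H) : Omits C G := by
  rintro K hK ⟨c⟩
  exact h K hK ⟨f.toCopy.comp c⟩

theorem omits_of_finite {C : Set FinGraph} {V : Type} {G : SimpleGraph V}
    (h : ∀ S : Set V, S.Finite → Omits C (G.induce S)) : Omits C G := by
  rintro K hK ⟨c⟩
  have := K.finite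
  refine h (Set.range c) (Set.finite_range c) K hK ⟨⟨⟨fun x => ⟨c x, x, rfl⟩, ?_⟩, ?_⟩⟩
  · intro x y hxy
    exact c.toHom.map_adj hxy
  · intro x y hxy
    exact c.injective (congrArg Subtype.val hxy)

theorem IsCountableFree.of_embedding {C : Set FinGraph} {V W : Type} {G : SimpleGraph V}
    {H : SimpleGraph W} (h : IsCountableFree C H) (f : G ↪g H) : IsCountableFree C G :=
  have := h.1
  ⟨f.injective.countable, h.2.of_embedding f⟩

/-- An enumeration of `A` serves as the marks and `B` as the pattern, which turns a statement about
sets into one about existential types. -/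
theorem isExistentiallyCompleteIn_iff {V W : Type} {G : SimpleGraph V} {H : SimpleGraph W}
    (f : G ↪g H) : IsExistentiallyCompleteIn f ↔
      ∀ (n : ℕ) (a : Fin n → V) (P : Pattern n), P.Holds H (f ∘ a) → P.Holds G a := by
  constructor
  · rintro h n a P ⟨g, hg⟩
    obtain ⟨e, he⟩ := h (Set.range a) (Set.range g) (Set.finite_range _) (Set.finite_range _) (by
      rintro _ ⟨_, ⟨i, rfl⟩, rfl⟩
      exact ⟨_, hg i⟩)
    refine ⟨e.comp (codEmbedding g fun x => ⟨x, rfl⟩), fun i => ?_⟩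
    exact he (a i) ⟨i, rfl⟩ _ (hg i).symm
  · intro h A B hA hB hAB
    have := hA.to_subtype
    let e := (Finite.equivFin A).symm
    let a : Fin (Nat.card A) → V := fun i => e i
    obtain ⟨P, -, hP, hP'⟩ := exists_pattern_of_set H (f ∘ a) hB
      (fun i => hAB ⟨a i, (e i).2, rfl⟩)
    obtain ⟨g, hg⟩ := (hP' V G a).1 (h _ a P hP)
    refine ⟨g, fun x hx b hb => ?_⟩
    obtain ⟨i, hi⟩ := e.surjective ⟨x, hx⟩
    have hi' : a i = x := congrArg Subtype.val hi
    rw [← hi', ← hg i]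
    congr 1
    apply Subtype.ext
    rw [← hb, ← hi']
    rfl

theorem IsExistentiallyComplete.holds {C : Set FinGraph} {V W : Type} {G : SimpleGraph V}
    {H : SimpleGraph W} (hG : IsExistentiallyComplete C G) (hH : IsCountableFree C H)
    (f : G ↪g H) {n : ℕ} {a : Fin n → V} {P : Pattern n} (hP : P.Holds H (f ∘ a)) :
    P.Holds G a :=
  (isExistentiallyCompleteIn_iff f).1 (hG.2 W H hH f) n a P hP

theorem IsExistentiallyComplete.exType_eq {C : Set FinGraph} {V W : Type} {G : SimpleGraph V}
    {H : SimpleGraph W} (hG : IsExistentiallyComplete C G) (hH : IsCountableFree C H)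
    (f : G ↪g H) {n : ℕ} (a : Fin n → V) : exType H (f ∘ a) = exType G a :=
  Set.Subset.antisymm (fun _ h => hG.holds hH f h) (fun _ h => Pattern.Holds.map h f)

theorem exists_lift_embedding {U V W : Type*} {A : SimpleGraph U} {B : SimpleGraph V}
    {H : SimpleGraph W} (g : A ↪g H) (f : B ↪g H) (h : Set.range g ⊆ Set.range f) :
    ∃ e : A ↪g B, ∀ x, f (e x) = g x := by
  choose e he using fun x => h ⟨x, rfl⟩
  refine ⟨⟨⟨e, fun x y hxy => g.injective ?_⟩, ?_⟩, he⟩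
  · rw [← he, ← he, hxy]
  · intro x y
    change B.Adj (e x) (e y) ↔ A.Adj x y
    rw [← f.map_adj_iff, he, he, g.map_adj_iff]

/-! ### Generic construction of existentially complete graphs -/

/-- A graph extending `G` by finitely many vertices and omitting `C`; only the part of `graph`
on the vertices of `G` and those in `carrier` matters. -/
structure Condition (C : Set FinGraph) {V : Type} (G : SimpleGraph V) where
  /-- the new vertices -/
  carrier : Finset ℕ
  /-- the graph -/
  graph : SimpleGraph (V ⊕ ℕ)
  base : ∀ v w, graph.Adj (Sum.inl v) (Sum.inl w) ↔ G.Adj v w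
  omits : Omits C (graph.induce {x | ∀ k, x = Sum.inr k → k ∈ carrier})

namespace Condition

variable {C : Set FinGraph} {V : Type} {G : SimpleGraph V}

/-- The vertices of the graph described by a condition. -/
def dom (p : Condition C G) : Set (V ⊕ ℕ) := {x | ∀ k, x = Sum.inr k → k ∈ p.carrier}

theorem inl_mem_dom (p : Condition C G) (v : V) : Sum.inl v ∈ p.dom := by
  intro k hk
  cases hk

/-- The graph described by a condition. -/
def toGraph (p : Condition C G) : SimpleGraph p.dom := p.graph.induce p.dom

/-- This is only a preorder: equivalent conditions may differ off `dom`, where the graph carries no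
information. -/
instance : Preorder (Condition C G) where
  le p q := p.dom ⊆ q.dom ∧ ∀ x ∈ p.dom, ∀ y ∈ p.dom, q.graph.Adj x y ↔ p.graph.Adj x y
  le_refl p := ⟨subset_rfl, fun _ _ _ _ => Iff.rfl⟩
  le_trans p q r hpq hqr := ⟨hpq.1.trans hqr.1, fun x hx y hy =>
    (hqr.2 x (hpq.1 hx) y (hpq.1 hy)).trans (hpq.2 x hx y hy)⟩

theorem exists_extension_singleton {W : Type} {H : SimpleGraph W} (hH : Omits C H)
    (p : Condition C G) (f : p.toGraph ↪g H) (w : W) :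
    ∃ (q : Condition C G) (hpq : p ≤ q) (f' : q.toGraph ↪g H),
      (∀ x : p.dom, f' ⟨x, hpq.1 x.2⟩ = f x) ∧ w ∈ Set.range f' := by
  classical
  by_cases hw : w ∈ Set.range f
  · exact ⟨p, le_rfl, f, fun x => rfl, hw⟩
  obtain ⟨k, hk⟩ := Infinite.exists_notMem_finset p.carrier
  let dom' : Set (V ⊕ ℕ) := {x | ∀ j, x = Sum.inr j → j ∈ insert k p.carrier}
  have hdom : p.dom ⊆ dom' := fun x hx j hj => Finset.mem_insert_of_mem (hx j hj)
  have hkdom : (Sum.inr k : V ⊕ ℕ) ∉ p.dom := fun h => hk (h k rfl)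
  have hkdom' : (Sum.inr k : V ⊕ ℕ) ∈ dom' := by
    rintro j hj
    cases hj
    exact Finset.mem_insert_self _ _
  have hnew : ∀ x ∈ dom', x ∉ p.dom → x = Sum.inr k := by
    rintro (v | j) hx hx'
    · exact absurd (p.inl_mem_dom v) hx'
    · rcases Finset.mem_insert.1 (hx j rfl) with rfl | hj
      · rfl
      · exfalso
        apply hx'
        rintro i hi
        cases hi
        exact hj
  let t : dom' → W := fun x => if h : x.1 ∈ p.dom then f ⟨x, h⟩ else w
  have ht : ∀ (x : V ⊕ ℕ) (hx : x ∈ dom') (h : x ∈ p.dom), t ⟨x, hx⟩ = f ⟨x, h⟩ :=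
    fun x hx h => dif_pos h
  have ht' : ∀ (x : dom'), x.1 ∉ p.dom → t x = w := fun x h => dif_neg h
  have htinj : Function.Injective t := by
    intro x y hxy
    by_cases hx : x.1 ∈ p.dom <;> by_cases hy : y.1 ∈ p.dom
    · rw [ht x x.2 hx, ht y y.2 hy] at hxy
      exact Subtype.ext (Subtype.mk.inj (f.injective hxy))
    · rw [ht x x.2 hx, ht' y hy] at hxy
      exact absurd ⟨_, hxy⟩ hw
    · rw [ht' x hx, ht y y.2 hy] at hxy
      exact absurd ⟨_, hxy.symm⟩ hw
    · exact Subtype.ext ((hnew x x.2 hx).trans (hnew y y.2 hy).symm)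
  -- The edges are pulled back from `H` along `t`, which sends the fresh label `k` to `w`; the new
  -- condition therefore embeds into `H` and inherits `Omits C`.
  let g : SimpleGraph (V ⊕ ℕ) :=
    { Adj := fun x y => ∃ (hx : x ∈ dom') (hy : y ∈ dom'), H.Adj (t ⟨x, hx⟩) (t ⟨y, hy⟩)
      symm := ⟨fun x y ⟨hx, hy, h⟩ => ⟨hy, hx, h.symm⟩⟩
      loopless := ⟨fun x ⟨hx, hy, h⟩ => H.loopless.irrefl _ h⟩ }
  have hg : ∀ x y (hx : x ∈ dom') (hy : y ∈ dom'),
      g.Adj x y ↔ H.Adj (t ⟨x, hx⟩) (t ⟨y, hy⟩) :=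
    fun x y hx hy => ⟨fun ⟨_, _, h⟩ => h, fun h => ⟨hx, hy, h⟩⟩
  have hgp : ∀ x ∈ p.dom, ∀ y ∈ p.dom, g.Adj x y ↔ p.graph.Adj x y := by
    intro x hx y hy
    rw [hg x y (hdom hx) (hdom hy), ht x _ hx, ht y _ hy, f.map_adj_iff]
    rfl
  let f' : g.induce dom' ↪g H := ⟨⟨t, htinj⟩, fun {x y} => (hg x y x.2 y.2).symm⟩
  refine ⟨⟨insert k p.carrier, g, fun v w => ?_, hH.of_embedding f'⟩, ⟨hdom, hgp⟩, f',
    fun x => ht x _ x.2, ⟨⟨Sum.inr k, hkdom'⟩, ht' _ hkdom⟩⟩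
  rw [hgp _ (p.inl_mem_dom v) _ (p.inl_mem_dom w), p.base]

theorem exists_extension {W : Type} {H : SimpleGraph W} (hH : Omits C H)
    (p : Condition C G) (f : p.toGraph ↪g H) {F : Set W} (hF : F.Finite) :
    ∃ (q : Condition C G) (hpq : p ≤ q) (f' : q.toGraph ↪g H),
      (∀ x : p.dom, f' ⟨x, hpq.1 x.2⟩ = f x) ∧ F ⊆ Set.range f' := by
  induction F, hF using Set.Finite.induction_on with
  | empty => exact ⟨p, le_rfl, f, fun x => rfl, Set.empty_subset _⟩
  | @insert w F _ _ ih =>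
    obtain ⟨q, hpq, f', hf', hF⟩ := ih
    obtain ⟨r, hqr, f'', hf'', hw⟩ := exists_extension_singleton hH q f' w
    refine ⟨r, hpq.trans hqr, f'', fun x => ?_, Set.insert_subset hw fun y hy => ?_⟩
    · rw [← hf' x]
      exact hf'' ⟨x, hpq.1 x.2⟩
    · obtain ⟨z, rfl⟩ := hF hy
      exact ⟨_, hf'' z⟩

/-- The condition `p` decides positively that `P` is realized at `a`. -/
def Realizes (p : Condition C G) {n : ℕ} (P : Pattern n) (a : Fin n → V ⊕ ℕ) : Prop :=
  ∃ h : ∀ i, a i ∈ p.dom, P.Holds p.toGraph (fun i => ⟨a i, h i⟩)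

/-- The graph obtained from an ideal of conditions. -/
def genericGraph (I : Order.Ideal (Condition C G)) :
    SimpleGraph {x : V ⊕ ℕ // ∃ p ∈ I, x ∈ p.dom} where
  Adj x y := ∃ p ∈ I, x.1 ∈ p.dom ∧ y.1 ∈ p.dom ∧ p.graph.Adj x y
  symm := ⟨fun _ _ ⟨p, hp, hx, hy, h⟩ => ⟨p, hp, hy, hx, h.symm⟩⟩
  loopless := ⟨fun _ ⟨p, _, _, _, h⟩ => p.graph.loopless.irrefl _ h⟩

theorem genericGraph_adj (I : Order.Ideal (Condition C G)) {p : Condition C G} (hp : p ∈ I)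
    {x y : {x : V ⊕ ℕ // ∃ p ∈ I, x ∈ p.dom}} (hx : x.1 ∈ p.dom) (hy : y.1 ∈ p.dom) :
    (genericGraph I).Adj x y ↔ p.graph.Adj x y := by
  refine ⟨?_, fun h => ⟨p, hp, hx, hy, h⟩⟩
  rintro ⟨q, hq, hx', hy', h⟩
  obtain ⟨r, -, hpr, hqr⟩ := I.directed p hp q hq
  rwa [← hpr.2 _ hx _ hy, hqr.2 _ hx' _ hy']

/-- The graph of a condition in an ideal embeds into the graph of the ideal. -/
def toGeneric (I : Order.Ideal (Condition C G)) {p : Condition C G} (hp : p ∈ I) :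
    p.toGraph ↪g genericGraph I where
  toFun x := ⟨x, p, hp, x.2⟩
  inj' _ _ hxy := Subtype.ext (Subtype.mk.inj hxy)
  map_rel_iff' {x y} := genericGraph_adj I hp x.2 y.2

theorem exists_mem_of_finite (I : Order.Ideal (Condition C G)) {q : Condition C G} (hq : q ∈ I)
    {S : Set {x : V ⊕ ℕ // ∃ p ∈ I, x ∈ p.dom}} (hS : S.Finite) :
    ∃ p ∈ I, q ≤ p ∧ ∀ x ∈ S, x.1 ∈ p.dom := by
  induction S, hS using Set.Finite.induction_on with
  | empty => exact ⟨q, hq, le_rfl, by simp⟩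
  | @insert x F _ _ ih =>
    obtain ⟨p, hp, hqp, h⟩ := ih
    obtain ⟨r, hr, hx⟩ := x.2
    obtain ⟨s, hs, hps, hrs⟩ := I.directed p hp r hr
    refine ⟨s, hs, hqp.trans hps, ?_⟩
    rintro y (rfl | hy)
    · exact hrs.1 hx
    · exact hps.1 (h y hy)

theorem omits_genericGraph (I : Order.Ideal (Condition C G)) : Omits C (genericGraph I) := by
  refine omits_of_finite fun S hS => ?_
  obtain ⟨q, hq⟩ := I.nonempty
  obtain ⟨p, hp, -, h⟩ := exists_mem_of_finite I hq hS
  refine Omits.of_embedding (H := p.toGraph) p.omits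
    ⟨⟨fun x => ⟨x.1.1, h x.1 x.2⟩, fun x y hxy => ?_⟩, fun {x y} => ?_⟩
  · exact Subtype.ext (Subtype.ext (Subtype.mk.inj hxy))
  · exact (genericGraph_adj I hp (h x.1 x.2) (h y.1 y.2)).symm

/-- The conditions deciding whether `P` is realized at `a`. -/
def deciding {n : ℕ} (P : Pattern n) (a : Fin n → V ⊕ ℕ) : Order.Cofinal (Condition C G) where
  carrier := {q | q.Realizes P a ∨ ∀ r ≥ q, ¬ r.Realizes P a}
  isCofinal p := by
    by_cases h : ∃ r ≥ p, r.Realizes P a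
    · obtain ⟨r, hr, h⟩ := h
      exact ⟨r, Or.inl h, hr⟩
    · push Not at h
      exact ⟨p, Or.inr h, le_rfl⟩

/-- If an extension `H` realizes `P` at `a`, no condition in `I` can decide `P` negatively: a finite
part of `H` can be copied into a stronger condition that realizes `P`. -/
theorem isExistentiallyComplete_genericGraph [Countable V] (I : Order.Ideal (Condition C G))
    (hI : ∀ (n : ℕ) (P : Pattern n) (a : Fin n → V ⊕ ℕ), ∃ q ∈ deciding P a, q ∈ I) :
    IsExistentiallyComplete C (genericGraph I) := by
  refine ⟨⟨inferInstance, omits_genericGraph I⟩, fun W H hH f => ?_⟩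
  rw [isExistentiallyCompleteIn_iff]
  rintro n a P ⟨g, hg⟩
  obtain ⟨q, hq, hqI⟩ := hI n P (fun i => (a i).1)
  rcases hq with ⟨h, hq⟩ | hq
  · exact hq.map (toGeneric I hqI)
  · exfalso
    obtain ⟨p, hp, hqp, h⟩ := exists_mem_of_finite I hqI (Set.finite_range a)
    obtain ⟨r, hpr, f', hf', hF⟩ :=
      exists_extension hH.2 p (f.comp (toGeneric I hp)) (Set.finite_range g)
    obtain ⟨e, he⟩ := exists_lift_embedding g f' hF
    refine hq r (hqp.trans hpr) ⟨fun i => hpr.1 (h _ ⟨i, rfl⟩), e, fun i => f'.injective ?_⟩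
    rw [he, hg]
    exact (hf' ⟨(a i).1, h _ ⟨i, rfl⟩⟩).symm

/-- The condition without new vertices. -/
def ofOmits (h : Omits C G) : Condition C G where
  carrier := ∅
  graph := G.map Function.Embedding.inl
  base v w := by
    change (G.map Function.Embedding.inl).Adj (Function.Embedding.inl v)
      (Function.Embedding.inl w) ↔ _
    exact SimpleGraph.map_adj_apply
  omits := by
    have hl : ∀ x : {x : V ⊕ ℕ | ∀ k, x = Sum.inr k → k ∈ (∅ : Finset ℕ)}, ∃ v, Sum.inl v = x.1 := by
      rintro ⟨v | k, hx⟩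
      · exact ⟨v, rfl⟩
      · exact absurd (hx k rfl) (Finset.notMem_empty _)
    choose t ht using hl
    refine h.of_embedding ⟨⟨t, fun x y hxy => Subtype.ext ?_⟩, fun {x y} => ?_⟩
    · rw [← ht, ← ht, hxy]
    · change G.Adj (t x) (t y) ↔ (G.map Function.Embedding.inl).Adj x.1 y.1
      rw [← ht x, ← ht y]
      exact SimpleGraph.map_adj_apply.symm

theorem finite_dom [Finite V] (p : Condition C G) : p.dom.Finite := by
  refine ((Set.finite_range Sum.inl).union (p.carrier.finite_toSet.image Sum.inr)).subset ?_
  rintro (v | k) h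
  · exact Or.inl ⟨v, rfl⟩
  · exact Or.inr ⟨k, h k rfl, rfl⟩

end Condition

open Condition

/-- Every countable graph omitting `C` embeds into an existentially complete one. -/
theorem exists_isExistentiallyComplete {C : Set FinGraph} {V : Type} {G : SimpleGraph V}
    (hG : IsCountableFree C G) :
    ∃ (W : Type) (H : SimpleGraph W), IsExistentiallyComplete C H ∧ Nonempty (G ↪g H) := by
  have := hG.1
  let p₀ : Condition C G := ofOmits hG.2
  have := Encodable.ofCountable (Σ n, Pattern n × (Fin n → V ⊕ ℕ))
  let 𝒟 : (Σ n, Pattern n × (Fin n → V ⊕ ℕ)) → Order.Cofinal (Condition C G) :=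
    fun x => deciding x.2.1 x.2.2
  let I := Order.idealOfCofinals p₀ 𝒟
  refine ⟨_, genericGraph I, isExistentiallyComplete_genericGraph I fun n P a => ?_, ⟨?_⟩⟩
  · exact Order.cofinal_meets_idealOfCofinals p₀ 𝒟 ⟨n, P, a⟩
  · have h₀ : p₀ ∈ I := Order.mem_idealOfCofinals p₀ 𝒟
    exact ⟨⟨fun v => ⟨Sum.inl v, p₀, h₀, p₀.inl_mem_dom v⟩, fun v w h =>
      Sum.inl_injective (congrArg Subtype.val h)⟩, fun {v w} =>
      (genericGraph_adj I h₀ (p₀.inl_mem_dom v) (p₀.inl_mem_dom w)).trans (p₀.base v w)⟩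

/-- Omitting types: a set of patterns none of whose members isolates it is omitted by some
existentially complete graph. -/
theorem exists_omitting {C : Set FinGraph} (hC : Omits C (⊥ : SimpleGraph Empty)) {n : ℕ}
    (p : Set (Pattern n))
    (hp : ∀ φ ∈ p, ∃ (V : Type) (G : SimpleGraph V) (a : Fin n → V), Omits C G ∧
      φ.Holds G a ∧ ∃ ψ ∉ p, ψ.Holds G a) :
    ∃ (W : Type) (H : SimpleGraph W), IsExistentiallyComplete C H ∧
      ∀ b : Fin n → W, exType H b ≠ p := by
  let p₀ : Condition C (⊥ : SimpleGraph Empty) := ofOmits hC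
  let refuting : (Fin n → Empty ⊕ ℕ) → Order.Cofinal (Condition C (⊥ : SimpleGraph Empty)) :=
    fun a =>
    -- The second alternative covers tuples that no stronger condition contains; it cannot occur for
    -- a tuple of the generic graph.
    { carrier := {q | (∃ ψ ∉ p, q.Realizes ψ a) ∨ ∀ r ≥ q, ¬ ∀ i, a i ∈ r.dom}
      isCofinal := fun q => by
        by_cases h : ∃ r ≥ q, ∀ i, a i ∈ r.dom
        · obtain ⟨r, hqr, hr⟩ := h
          have := r.finite_dom.to_subtype
          -- The base graph is empty, so `r` is finite and is itself a pattern `φ` at `a`. If `φ ∈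
          -- p`, the graph supplied by `hp` contains `r` together with a witness for some `ψ ∉ p`,
          -- which is added to `r`; otherwise `φ` already lies outside `p`.
          obtain ⟨φ, -, hφ⟩ := exists_pattern_of_finite r.toGraph (fun i => ⟨a i, hr i⟩)
          have hφr : r.Realizes φ a := ⟨hr, (hφ _ _ _).2 ⟨SimpleGraph.Embedding.refl, fun i => rfl⟩⟩
          by_cases hφp : φ ∈ p
          · obtain ⟨V, G, a', hG, hφa, ψ, hψ, g, hg⟩ := hp φ hφp
            obtain ⟨f, hf⟩ := (hφ _ _ _).1 hφa
            obtain ⟨s, hrs, f', hf', hF⟩ := exists_extension hG r f (Set.finite_range g)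
            obtain ⟨e, he⟩ := exists_lift_embedding g f' hF
            refine ⟨s, Or.inl ⟨ψ, hψ, fun i => hrs.1 (hr i), e, fun i => f'.injective ?_⟩,
              hqr.trans hrs⟩
            rw [he, hg, ← hf]
            exact (hf' ⟨a i, hr i⟩).symm
          · exact ⟨r, Or.inl ⟨φ, hφp, hφr⟩, hqr⟩
        · push Not at h
          refine ⟨q, Or.inr fun r hr h' => ?_, le_rfl⟩
          obtain ⟨i, hi⟩ := h r hr
          exact hi (h' i) }
  have := Encodable.ofCountable
    ((Σ n, Pattern n × (Fin n → Empty ⊕ ℕ)) ⊕ (Fin n → Empty ⊕ ℕ))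
  let 𝒟 : ((Σ n, Pattern n × (Fin n → Empty ⊕ ℕ)) ⊕ (Fin n → Empty ⊕ ℕ)) →
      Order.Cofinal (Condition C (⊥ : SimpleGraph Empty)) :=
    Sum.elim (fun x => deciding x.2.1 x.2.2) refuting
  let I := Order.idealOfCofinals p₀ 𝒟
  refine ⟨_, genericGraph I, isExistentiallyComplete_genericGraph I fun n P a => ?_, fun b hb => ?_⟩
  · exact Order.cofinal_meets_idealOfCofinals p₀ 𝒟 (Sum.inl ⟨n, P, a⟩)
  · obtain ⟨q, hq, hqI⟩ := Order.cofinal_meets_idealOfCofinals p₀ 𝒟 (Sum.inr fun i => (b i).1)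
    rcases hq with ⟨ψ, hψ, h, hψq⟩ | hq
    · apply hψ
      rw [← hb]
      exact hψq.map (toGeneric I hqI)
    · obtain ⟨r, -, hqr, h⟩ := exists_mem_of_finite I hqI (Set.finite_range b)
      exact hq r hqr fun i => h _ ⟨i, rfl⟩

/-! ### Translation into first-order logic -/

open Language Filter

/-- The existential formula expressing that a pattern holds. -/
noncomputable def Pattern.formula {n : ℕ} (P : Pattern n) : Language.graph.Formula (Fin n) :=
  open Classical in
  Formula.iExs (Fin P.size)
    ((Formula.iInf fun i : Fin n =>
        Term.equal (Term.var (Sum.inr (P.pt i))) (Term.var (Sum.inl i))) ⊓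
      ((Formula.iInf fun x : Fin P.size × Fin P.size =>
          if x.1 = x.2 then ⊤ else
            ∼(Term.equal (Term.var (Sum.inr x.1)) (Term.var (Sum.inr x.2)))) ⊓
        Formula.iInf fun x : Fin P.size × Fin P.size =>
          if P.graph.Adj x.1 x.2 then
            adj.formula₂ (Term.var (Sum.inr x.1)) (Term.var (Sum.inr x.2))
          else ∼(adj.formula₂ (Term.var (Sum.inr x.1)) (Term.var (Sum.inr x.2)))))

theorem realize_adj {V : Type*} (G : SimpleGraph V) {α : Type*} (s t : Language.graph.Term α)
    (v : α → V) : @Formula.Realize _ V G.structure _ (adj.formula₂ s t) v ↔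
      G.Adj (@Term.realize _ V G.structure _ v s) (@Term.realize _ V G.structure _ v t) := by
  let := G.structure
  rw [Formula.realize_rel₂]
  rfl

theorem Pattern.realize_formula {n : ℕ} (P : Pattern n) {V : Type*} (G : SimpleGraph V)
    (a : Fin n → V) : @Formula.Realize _ V G.structure _ P.formula a ↔ P.Holds G a := by
  let := G.structure
  rw [Pattern.formula, Formula.realize_iExs]
  constructor
  · rintro ⟨g, hg⟩
    rw [Formula.realize_inf, Formula.realize_inf, Formula.realize_iInf, Formula.realize_iInf,
      Formula.realize_iInf] at hg
    obtain ⟨h1, h2, h3⟩ := hg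
    refine ⟨⟨⟨g, fun x y hxy => ?_⟩, fun {x y} => ?_⟩, fun i => ?_⟩
    · by_contra hne
      have := h2 (x, y)
      rw [if_neg hne, Formula.realize_not, Formula.realize_equal] at this
      exact this hxy
    · have := h3 (x, y)
      change G.Adj (g x) (g y) ↔ _
      by_cases h : P.graph.Adj x y
      · rw [if_pos h, realize_adj] at this
        exact iff_of_true this h
      · rw [if_neg h, Formula.realize_not, realize_adj] at this
        exact iff_of_false this h
    · have := h1 i
      rw [Formula.realize_equal] at this
      exact this
  · rintro ⟨g, hg⟩
    refine ⟨g, ?_⟩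
    rw [Formula.realize_inf, Formula.realize_inf, Formula.realize_iInf, Formula.realize_iInf,
      Formula.realize_iInf]
    refine ⟨fun i => ?_, fun x => ?_, fun x => ?_⟩
    · rw [Formula.realize_equal]
      exact hg i
    · split_ifs with h
      · exact BoundedFormula.realize_top.2 trivial
      · rw [Formula.realize_not, Formula.realize_equal]
        exact fun h' => h (g.injective h')
    · split_ifs with h
      · rw [realize_adj]
        exact g.map_adj_iff.2 h
      · rw [Formula.realize_not, realize_adj]
        exact fun h' => h (g.map_adj_iff.1 h')

/-- The universal closure of a formula. -/
noncomputable def allClosure {n : ℕ} (φ : Language.graph.Formula (Fin n)) :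
    Language.graph.Sentence :=
  Formula.iAlls (Fin n) (φ.relabel (Sum.inr : Fin n → Empty ⊕ Fin n))

theorem realize_allClosure {n : ℕ} (φ : Language.graph.Formula (Fin n)) {V : Type*}
    [Language.graph.Structure V] : V ⊨ allClosure φ ↔ ∀ a : Fin n → V, φ.Realize a := by
  rw [Sentence.Realize, allClosure, Formula.realize_iAlls]
  refine forall_congr' fun a => ?_
  rw [Formula.realize_relabel]
  rfl

theorem realize_of_model_theoryStar {C : Set FinGraph} {V : Type} [Language.graph.Structure V]
    (hV : V ⊨ theoryStar C) {n : ℕ} (φ : Language.graph.Formula (Fin n))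
    (h : ∀ (W : Type) (G : SimpleGraph W), IsExistentiallyComplete C G →
      ∀ a : Fin n → W, @Formula.Realize _ W G.structure _ φ a) (a : Fin n → V) : φ.Realize a := by
  refine (realize_allClosure φ).1 (hV.realize_of_mem _ fun W G hG => ?_) a
  let := G.structure
  exact (realize_allClosure φ).2 (h W G hG)

theorem exists_simpleGraph_of_model {V : Type*} [S : Language.graph.Structure V]
    (h : V ⊨ Theory.simpleGraph) : ∃ G : SimpleGraph V, S = G.structure :=
  ⟨simpleGraphOfStructure V, structure_simpleGraphOfStructure.symm⟩

theorem model_simpleGraph_of_theoryStar {C : Set FinGraph} {V : Type}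
    [Language.graph.Structure V] (hV : V ⊨ theoryStar C) : V ⊨ Theory.simpleGraph :=
  ⟨fun φ hφ => hV.realize_of_mem φ fun _ G _ =>
    let := G.structure
    (simpleGraph_model G).realize_of_mem φ hφ⟩

/-- If every finite configuration found in `G` is found in some graph omitting `C`, then `G`
omits `C`. -/
theorem omits_of_patterns {C : Set FinGraph} {V : Type} {G : SimpleGraph V}
    (h : ∀ P : Pattern 0, P.Holds G Fin.elim0 →
      ∃ (W : Type) (H : SimpleGraph W), Omits C H ∧ P.Holds H Fin.elim0) : Omits C G := by
  refine omits_of_finite fun S hS => ?_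
  obtain ⟨P, -, hP, hP'⟩ := exists_pattern_of_set G Fin.elim0 hS (fun i => i.elim0)
  obtain ⟨W, H, hH, hPH⟩ := h P hP
  obtain ⟨g, -⟩ := (hP' W H _).1 hPH
  exact hH.of_embedding g

theorem omits_of_model_theoryStar {C : Set FinGraph} {V : Type} {G : SimpleGraph V}
    (hV : letI := G.structure; V ⊨ theoryStar C) : Omits C G := by
  refine omits_of_patterns fun P hP => ?_
  -- A pattern occurring in no graph omitting `C` has its negation in the theory, so it cannot hold
  -- in a model.
  by_contra! hcon
  let := G.structure
  refine realize_of_model_theoryStar hV (∼P.formula) (fun W H hH a => ?_) Fin.elim0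
    ((P.realize_formula G _).2 hP)
  intro h
  rw [Subsingleton.elim a Fin.elim0] at h
  exact hcon W H hH.1.2 ((P.realize_formula H _).1 h)

theorem model_theoryStar {C : Set FinGraph} {V : Type} {G : SimpleGraph V}
    (hG : IsExistentiallyComplete C G) : letI := G.structure; V ⊨ theoryStar C :=
  let := G.structure
  ⟨fun _ hφ => hφ V G hG⟩

/-! ### Maximality of existential types -/

/-- Amalgamation and maximality: in an existentially complete graph existential types are
maximal among those realized in graphs omitting `C`. -/
theorem IsExistentiallyComplete.exType_eq_of_subset {C : Set FinGraph} {V V' : Type}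
    {G : SimpleGraph V} {G' : SimpleGraph V'} (hG : IsExistentiallyComplete C G)
    (hG' : Omits C G') {n : ℕ} {a : Fin n → V} {a' : Fin n → V'}
    (h : exType G a ⊆ exType G' a') : exType G a = exType G' a' := by
  refine Set.Subset.antisymm h fun ψ hψ => ?_
  -- The gluing below needs a default vertex of `V'`, so the empty case is separate; there `ψ` has
  -- no vertices.
  rcases isEmpty_or_nonempty V' with hV' | hV'
  · obtain ⟨g, -⟩ := hψ
    have : IsEmpty (Fin ψ.size) := ⟨fun x => hV'.false (g x)⟩
    exact ⟨⟨⟨isEmptyElim, fun x => isEmptyElim x⟩, fun {x} => isEmptyElim x⟩,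
      fun i => isEmptyElim (ψ.pt i)⟩
  have := hG.1.1
  let T : Finset V → Set V := fun s => ↑s ∪ Set.range a
  have hT : ∀ s, (T s).Finite := fun s => s.finite_toSet.union (Set.finite_range a)
  have haT : ∀ s i, a i ∈ T s := fun s i => Or.inr ⟨i, rfl⟩
  have hex : ∀ s, ∃ g : G.induce (T s) ↪g G', ∀ i, g ⟨a i, haT s i⟩ = a' i := by
    intro s
    obtain ⟨P, -, hP, hP'⟩ := exists_pattern_of_set G a (hT s) (haT s)
    exact (hP' V' G' a').1 (h hP)
  choose g hg using hex
  classical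
  -- Each finite part of `G` around `a` embeds into `G'` with `a ↦ a'`. Each vertex lies in `T s`
  -- for almost all `s`, so these partial maps glue to an embedding `J` of `G` into the ultrapower
  -- `H` of `G'`.
  let u : Ultrafilter (Finset V) := Ultrafilter.of atTop
  have hu : ∀ x : V, ∀ᶠ s in u, x ∈ T s := fun x =>
    Ultrafilter.of_le atTop ((eventually_ge_atTop {x}).mono fun s hs =>
      Or.inl (hs (Finset.mem_singleton_self x)))
  let := G'.structure
  let M := (u : Filter (Finset V)).Product (fun _ => V')
  have hM : M ⊨ Theory.simpleGraph := ⟨fun φ hφ => by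
    rw [Ultraproduct.sentence_realize]
    exact Eventually.of_forall fun _ => (simpleGraph_model G').realize_of_mem φ hφ⟩
  obtain ⟨H, hH⟩ := exists_simpleGraph_of_model hM
  let mk : (Finset V → V') → M := fun x => (x : (u : Filter (Finset V)).Product fun _ => V')
  have los : ∀ {k : ℕ} (φ : Language.graph.Formula (Fin k)) (x : Fin k → Finset V → V'),
      @Formula.Realize _ M H.structure _ φ (fun i => mk (x i)) ↔
        ∀ᶠ s in u, φ.Realize fun i => x i s := by
    intro k φ x
    rw [← hH]
    exact Ultraproduct.realize_formula_cast φ x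
  have holds_iff : ∀ {k : ℕ} (P : Pattern k) (x : Fin k → Finset V → V'),
      P.Holds H (fun i => mk (x i)) ↔ ∀ᶠ s in u, P.Holds G' fun i => x i s := by
    intro k P x
    rw [← P.realize_formula H, los]
    simp only [Pattern.realize_formula]
  have adj_iff : ∀ x y : Finset V → V', H.Adj (mk x) (mk y) ↔ ∀ᶠ s in u, G'.Adj (x s) (y s) := by
    intro x y
    have := los (adj.formula₂ (Term.var (0 : Fin 2)) (Term.var (1 : Fin 2))) ![x, y]
    simp only [realize_adj] at this
    exact this
  have eq_iff : ∀ x y : Finset V → V', mk x = mk y ↔ ∀ᶠ s in u, x s = y s :=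
    fun x y => Quotient.eq''
  let j : V → Finset V → V' := fun x s => if hx : x ∈ T s then g s ⟨x, hx⟩ else hV'.some
  have hj : ∀ x s (hx : x ∈ T s), j x s = g s ⟨x, hx⟩ := fun x s hx => dif_pos hx
  let J : G ↪g H :=
    { toFun := fun x => mk (j x)
      inj' := fun x y hxy => by
        obtain ⟨s, h1, h2, h3⟩ := (((eq_iff _ _).1 hxy).and ((hu x).and (hu y))).exists
        rw [hj x s h2, hj y s h3] at h1
        exact Subtype.mk.inj ((g s).injective h1)
      map_rel_iff' := fun {x y} => by
        change H.Adj (mk (j x)) (mk (j y)) ↔ _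
        rw [adj_iff]
        have hxy : ∀ᶠ s in u, (G'.Adj (j x s) (j y s) ↔ G.Adj x y) := by
          filter_upwards [hu x, hu y] with s h2 h3
          rw [hj x s h2, hj y s h3, (g s).map_adj_iff]
          rfl
        rw [eventually_congr hxy, eventually_const] }
  have hJa : ∀ i, J (a i) = mk (fun _ => a' i) := by
    intro i
    change mk (j (a i)) = _
    congr 1
    funext s
    rw [hj _ s (haT s i), hg]
  have hψH : ψ.Holds H (J ∘ a) := by
    have : J ∘ a = fun i => mk (fun _ => a' i) := funext hJa
    rw [this, holds_iff]
    exact Eventually.of_forall fun _ => hψ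
  have hHC : Omits C H := by
    refine omits_of_patterns fun P hP => ⟨V', G', hG', ?_⟩
    have e : (Fin.elim0 : Fin 0 → M) = fun i => mk (Fin.elim0 i) :=
      Subsingleton.elim _ _
    rw [e, holds_iff] at hP
    obtain ⟨s, hs⟩ := hP.exists
    rwa [Subsingleton.elim (fun i : Fin 0 => (Fin.elim0 i : Finset V → V') s) Fin.elim0] at hs
  obtain ⟨f, hf⟩ := hψH
  -- The ultrapower may be uncountable, whereas existential completeness tests only countable
  -- extensions; `G` and one witness for `ψ` suffice.
  let W : Set M := Set.range J ∪ Set.range f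
  have hW : Countable W := ((Set.countable_range J).union (Set.countable_range f)).to_subtype
  have hfree : IsCountableFree C (H.induce W) :=
    ⟨hW, hHC.of_embedding (SimpleGraph.Embedding.induce W)⟩
  refine hG.holds hfree (codEmbedding J fun x => Or.inl ⟨x, rfl⟩)
    ⟨codEmbedding f fun x => Or.inr ⟨x, rfl⟩, fun i => Subtype.ext (hf i)⟩

/-! ### Isolated types and back and forth -/

/-- Every existential type realized in an existentially complete graph is isolated by one of its
patterns. -/
def TypesIsolated (C : Set FinGraph) : Prop :=
  ∀ (n : ℕ) (V : Type) (G : SimpleGraph V) (a : Fin n → V), IsExistentiallyComplete C G →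
    ∃ φ : Pattern n, φ.Holds G a ∧ ∀ (V' : Type) (G' : SimpleGraph V') (a' : Fin n → V'),
      IsExistentiallyComplete C G' → φ.Holds G' a' → exType G' a' = exType G a

theorem eq_and_adj_iff_of_exType_subset {n : ℕ} {V V' : Type} {G : SimpleGraph V}
    {G' : SimpleGraph V'} {a : Fin n → V} {a' : Fin n → V'} (h : exType G a ⊆ exType G' a')
    (i j : Fin n) : (a i = a j ↔ a' i = a' j) ∧ (G.Adj (a i) (a j) ↔ G'.Adj (a' i) (a' j)) := by
  obtain ⟨P, -, hP, hP'⟩ :=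
    exists_pattern_of_set G a (Set.finite_range a) (fun i => ⟨i, rfl⟩)
  obtain ⟨g, hg⟩ := (hP' _ _ _).1 (h hP)
  rw [← hg i, ← hg j, g.injective.eq_iff, g.map_adj_iff]
  exact ⟨⟨fun h => Subtype.ext h, fun h => Subtype.mk.inj h⟩, Iff.rfl⟩

/-- Forgetting the last mark of the pattern isolating the type of `(a, b)` leaves a pattern in the
type of `a`, hence in that of `a'`. The image of the forgotten mark is `b'`, and isolation
determines its whole type. -/
theorem TypesIsolated.exists_snoc {C : Set FinGraph} (hC : TypesIsolated C) {n : ℕ} {V V' : Type}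
    {G : SimpleGraph V} {G' : SimpleGraph V'} {a : Fin n → V} {a' : Fin n → V'}
    (hG : IsExistentiallyComplete C G) (hG' : IsExistentiallyComplete C G')
    (h : exType G a = exType G' a') (b : V) :
    ∃ b' : V', exType G (Fin.snoc a b : Fin (n + 1) → V) =
      exType G' (Fin.snoc a' b' : Fin (n + 1) → V') := by
  obtain ⟨φ, ⟨f, hf⟩, hφ'⟩ := hC (n + 1) V G (Fin.snoc a b) hG
  have hP : (⟨φ.size, φ.graph, fun i => φ.pt i.castSucc⟩ : Pattern n) ∈ exType G a :=
    ⟨f, fun i => by simpa using hf i.castSucc⟩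
  rw [h] at hP
  obtain ⟨g, hg⟩ := hP
  refine ⟨g (φ.pt (Fin.last n)), (hφ' _ _ _ hG' ⟨g, fun i => ?_⟩).symm⟩
  induction i using Fin.lastCases with
  | last => simp
  | cast i => simpa using hg i

/-- Pairs of tuples of the same existential type. -/
structure TypePair {V V' : Type} (G : SimpleGraph V) (G' : SimpleGraph V') where
  /-- the length -/
  len : ℕ
  /-- the first tuple -/
  fst : Fin len → V
  /-- the second tuple -/
  snd : Fin len → V'
  eq : exType G fst = exType G' snd

namespace TypePair

variable {V V' : Type} {G : SimpleGraph V} {G' : SimpleGraph V'}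

/-- The finite correspondence given by a pair of tuples. -/
def graph (x : TypePair G G') : Set (V × V') := Set.range fun i => (x.fst i, x.snd i)

instance : Preorder (TypePair G G') := Preorder.lift graph

theorem le_snoc {x y : TypePair G G'} (v : V) (v' : V') (h : y.len = x.len + 1)
    (h1 : ∀ i, y.fst (Fin.cast h.symm i) = (Fin.snoc x.fst v : Fin (x.len + 1) → V) i)
    (h2 : ∀ i, y.snd (Fin.cast h.symm i) = (Fin.snoc x.snd v' : Fin (x.len + 1) → V') i) :
    x ≤ y := by
  rintro _ ⟨i, rfl⟩
  exact ⟨Fin.cast h.symm i.castSucc, by simp only [h1, h2, Fin.snoc_castSucc]⟩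

end TypePair

open TypePair

/-- Back and forth. -/
theorem TypesIsolated.exists_iso {C : Set FinGraph} (hC : TypesIsolated C) {n : ℕ} {V V' : Type}
    {G : SimpleGraph V} {G' : SimpleGraph V'} {a : Fin n → V} {a' : Fin n → V'}
    (hG : IsExistentiallyComplete C G) (hG' : IsExistentiallyComplete C G')
    (h : exType G a = exType G' a') : ∃ σ : G ≃g G', ∀ i, σ (a i) = a' i := by
  have := hG.1.1
  have := hG'.1.1
  have := Encodable.ofCountable (V ⊕ V')
  let p₀ : TypePair G G' := ⟨n, a, a', h⟩
  let left : V → Order.Cofinal (TypePair G G') := fun v =>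
    { carrier := {x | ∃ i, x.fst i = v}
      isCofinal := fun x => by
        obtain ⟨v', hv'⟩ := hC.exists_snoc hG hG' x.eq v
        exact ⟨⟨x.len + 1, _, _, hv'⟩, ⟨Fin.last _, by simp⟩,
          le_snoc v v' rfl (fun _ => rfl) fun _ => rfl⟩ }
  let right : V' → Order.Cofinal (TypePair G G') := fun v' =>
    { carrier := {x | ∃ i, x.snd i = v'}
      isCofinal := fun x => by
        obtain ⟨v, hv⟩ := hC.exists_snoc hG' hG x.eq.symm v'
        exact ⟨⟨x.len + 1, _, _, hv.symm⟩, ⟨Fin.last _, by simp⟩,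
          le_snoc v v' rfl (fun _ => rfl) fun _ => rfl⟩ }
  let 𝒟 : V ⊕ V' → Order.Cofinal (TypePair G G') := Sum.elim left right
  let I := Order.idealOfCofinals p₀ 𝒟
  have hleft : ∀ v, ∃ v', ∃ x ∈ I, (v, v') ∈ x.graph := by
    intro v
    obtain ⟨x, ⟨i, hi⟩, hxI⟩ := Order.cofinal_meets_idealOfCofinals p₀ 𝒟 (Sum.inl v)
    exact ⟨x.snd i, x, hxI, i, by simp only [hi]⟩
  have hright : ∀ v', ∃ v, ∃ x ∈ I, (v, v') ∈ x.graph := by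
    intro v'
    obtain ⟨x, ⟨i, hi⟩, hxI⟩ := Order.cofinal_meets_idealOfCofinals p₀ 𝒟 (Sum.inr v')
    exact ⟨x.fst i, x, hxI, i, by simp only [hi]⟩
  -- By directedness both pairs lie in one finite correspondence between tuples of equal type, which
  -- respects equality and adjacency.
  have key : ∀ v v' w w', (∃ x ∈ I, (v, v') ∈ x.graph) → (∃ x ∈ I, (w, w') ∈ x.graph) →
      (v = w ↔ v' = w') ∧ (G.Adj v w ↔ G'.Adj v' w') := by
    rintro v v' w w' ⟨x, hx, hvx⟩ ⟨y, hy, hwy⟩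
    obtain ⟨z, -, hxz, hyz⟩ := I.directed x hx y hy
    obtain ⟨i, hi⟩ := hxz hvx
    obtain ⟨j, hj⟩ := hyz hwy
    have := eq_and_adj_iff_of_exType_subset z.eq.subset i j
    simp only [Prod.mk.injEq] at hi hj
    rwa [hi.1, hi.2, hj.1, hj.2] at this
  choose f hf using hleft
  have hbij : Function.Bijective f := by
    constructor
    · intro v w hvw
      exact (key v _ w _ (hf v) (hf w)).1.2 hvw
    · intro v'
      obtain ⟨v, hv⟩ := hright v'
      exact ⟨v, (key v _ v _ (hf v) hv).1.1 rfl⟩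
  refine ⟨⟨Equiv.ofBijective f hbij, fun {v w} => (key v _ w _ (hf v) (hf w)).2.symm⟩, fun i => ?_⟩
  exact (key (a i) _ (a i) _ (hf (a i))
    ⟨p₀, Order.mem_idealOfCofinals p₀ 𝒟, i, rfl⟩).1.1 rfl

/-- If finitely many existential types are realized, each of them is isolated. -/
theorem typesIsolated_of_finite {C : Set FinGraph}
    (h : ∀ n, {p : Set (Pattern n) | ∃ (V : Type) (G : SimpleGraph V) (a : Fin n → V),
      IsExistentiallyComplete C G ∧ exType G a = p}.Finite) : TypesIsolated C := by
  intro n V G a hG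
  -- By maximality the given type is not contained in any other realized type; one separating
  -- pattern per rival, conjoined, isolates it.
  have hsep : ∀ q ∈ {p : Set (Pattern n) | ∃ (V : Type) (G : SimpleGraph V) (a : Fin n → V),
      IsExistentiallyComplete C G ∧ exType G a = p}, q ≠ exType G a →
      ∃ ψ : Pattern n, ψ ∈ exType G a ∧ ψ ∉ q := by
    rintro q ⟨V', G', a', hG', rfl⟩ hne
    by_contra! hcon
    exact hne (hG.exType_eq_of_subset hG'.1.2 hcon).symm
  have : Nonempty (Pattern n) := ⟨⟨n, ⊥, id⟩⟩
  choose! ψ hψ using hsep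
  obtain ⟨φ, hφ, hφ'⟩ := exists_pattern_imp G a
    (((h n).subset (Set.sep_subset _ fun q => q ≠ exType G a)).image ψ) (by
      rintro _ ⟨q, ⟨hq, hne⟩, rfl⟩
      exact (hψ q hq hne).1)
  refine ⟨φ, hφ, fun V' G' a' hG' hφG' => ?_⟩
  by_contra hne
  exact (hψ _ ⟨V', G', a', hG', rfl⟩ hne).2
    (hφ' _ _ _ hφG' _ ⟨_, ⟨⟨V', G', a', hG', rfl⟩, hne⟩, rfl⟩)

/-! ### Doubling a graph and moving finite sets by automorphisms -/

/-- The free amalgam of two copies of `G` over `A`. -/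
def double {V : Type} (G : SimpleGraph V) (A : Set V) :
    SimpleGraph {p : V × Bool // p.1 ∈ A → p.2 = false} where
  Adj p q := G.Adj p.1.1 q.1.1 ∧ (p.1.2 = q.1.2 ∨ p.1.1 ∈ A ∨ q.1.1 ∈ A)
  symm := ⟨fun _ _ ⟨h, h'⟩ => ⟨h.symm, h'.imp Eq.symm Or.symm⟩⟩
  loopless := ⟨fun _ ⟨h, _⟩ => G.loopless.irrefl _ h⟩

/-- In graphs omitting `C`, every tuple lies in a finite set of bounded size over which the graph
can be freely amalgamated with itself. -/
def HasBoundedClosure (C : Set FinGraph) : Prop :=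
  ∃ f : ℕ → ℕ, ∀ (V : Type) (G : SimpleGraph V), IsCountableFree C G →
    ∀ (n : ℕ) (a : Fin n → V), ∃ B : Set V, B.Finite ∧ Set.range a ⊆ B ∧ B.ncard ≤ f n ∧
      Omits C (double G B)

/-- The double of a graph over a trace embeds into the double of the larger graph. -/
def doubleEmbedding {V W : Type} {G : SimpleGraph V} {H : SimpleGraph W} (f : G ↪g H)
    (B : Set W) : double G (f ⁻¹' B) ↪g double H B where
  toFun p := ⟨(f p.1.1, p.1.2), p.2⟩
  inj' p q h := by
    have h' := Subtype.mk.inj h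
    simp only [Prod.mk.injEq] at h'
    exact Subtype.ext (Prod.ext (f.injective h'.1) h'.2)
  map_rel_iff' {p q} := and_congr_left' f.map_adj_iff

/-- A forbidden copy in the double is finite. An automorphism fixing `B` that moves its second half
off its first half folds it injectively into `G`. -/
theorem omits_double_of_moving {C : Set FinGraph} {V : Type} {G : SimpleGraph V} {B : Set V}
    (hG : Omits C G) (h : ∀ S T : Set V, S.Finite → T.Finite → Disjoint T B →
      ∃ σ : G ≃g G, (∀ x ∈ B, σ x = x) ∧ ∀ x ∈ T, σ x ∉ S) : Omits C (double G B) := by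
  rintro K hK ⟨c⟩
  have := K.finite
  obtain ⟨σ, hσB, hσ⟩ := h {v | ∃ x, (c x).1 = (v, false)} {v | ∃ x, (c x).1 = (v, true)}
    ((Set.finite_range fun x => (c x).1.1).subset (by
      rintro v ⟨x, hx⟩
      exact ⟨x, congrArg Prod.fst hx⟩))
    ((Set.finite_range fun x => (c x).1.1).subset (by
      rintro v ⟨x, hx⟩
      exact ⟨x, congrArg Prod.fst hx⟩))
    (Set.disjoint_left.2 (by
      rintro v ⟨x, hx⟩ hv
      have := (c x).2 (by rw [hx]; exact hv)
      rw [hx] at this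
      cases this))
  let F : {p : V × Bool // p.1 ∈ B → p.2 = false} → V := fun p => cond p.1.2 (σ p.1.1) p.1.1
  have hF : ∀ p, p.1.1 ∈ B → F p = σ p.1.1 := by
    rintro ⟨⟨v, b⟩, hb⟩ hv
    cases b
    · exact (hσB v hv).symm
    · rfl
  have hadj : ∀ p q, (double G B).Adj p q → G.Adj (F p) (F q) := by
    rintro ⟨⟨v, b⟩, hb⟩ ⟨⟨w, d⟩, hd⟩ ⟨hvw, h⟩
    change G.Adj v w at hvw
    have hs : G.Adj (σ v) (σ w) := σ.map_adj_iff.2 hvw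
    rcases h with h | h | h
    · change b = d at h
      subst h
      cases b
      · exact hvw
      · exact hs
    · have hb' : b = false := hb h
      subst hb'
      cases d
      · exact hvw
      · rw [hF _ h]
        exact hs
    · have hd' : d = false := hd h
      subst hd'
      cases b
      · exact hvw
      · rw [hF ⟨(w, false), hd⟩ h]
        exact hs
  refine hG K hK ⟨⟨⟨fun x => F (c x), fun hxy => hadj _ _ (c.toHom.map_adj hxy)⟩, ?_⟩⟩
  intro x y hxy
  apply c.injective
  change F (c x) = F (c y) at hxy
  rcases hx : c x with ⟨⟨v, b⟩, hb⟩
  rcases hy : c y with ⟨⟨w, d⟩, hd⟩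
  rw [hx, hy] at hxy
  have hx' : (c x).1 = (v, b) := by rw [hx]
  have hy' : (c y).1 = (w, d) := by rw [hy]
  cases b <;> cases d
  · have : v = w := hxy
    subst this
    rfl
  · exact absurd ⟨x, hx'.trans (congrArg (·, false) hxy)⟩ (hσ w ⟨y, hy'⟩)
  · exact absurd ⟨y, hy'.trans (congrArg (·, false) hxy.symm)⟩ (hσ v ⟨x, hx'⟩)
  · have : v = w := σ.injective hxy
    subst this
    rfl

open scoped Pointwise in
/-- P. M. Neumann's separation lemma. -/
theorem exists_smul_notMem_of_infinite_orbits {T V : Type*} [Group T] [MulAction T V]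
    {S R : Set V} (hS : S.Finite) (hR : R.Finite)
    (h : ∀ x ∈ R, (MulAction.orbit T x).Infinite) : ∃ g : T, ∀ x ∈ R, g • x ∉ S := by
  classical
  by_contra! hcon
  -- If every `g` sends some point of `R` into `S`, these pairs index finitely many cosets of point
  -- stabilizers covering the group. By the coset-cover theorem one stabilizer has finite index, so
  -- its orbit is finite.
  let s : Finset (V × V) := (hR.toFinset ×ˢ hS.toFinset).filter fun p => ∃ g : T, g • p.1 = p.2
  have hs : ∀ p : V × V, ∃ g : T, p ∈ s → g • p.1 = p.2 := by
    intro p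
    by_cases hp : p ∈ s
    · obtain ⟨g, hg⟩ := (Finset.mem_filter.1 hp).2
      exact ⟨g, fun _ => hg⟩
    · exact ⟨1, fun h => absurd h hp⟩
  choose g hg using hs
  have hcov : ⋃ p ∈ s, g p • (MulAction.stabilizer T p.1 : Set T) = Set.univ := by
    rw [Set.eq_univ_iff_forall]
    intro t
    obtain ⟨x, hx, hxS⟩ := hcon t
    have hp : (x, t • x) ∈ s := Finset.mem_filter.2
      ⟨Finset.mem_product.2 ⟨hR.mem_toFinset.2 hx, hS.mem_toFinset.2 hxS⟩, t, rfl⟩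
    refine Set.mem_biUnion hp ?_
    rw [mem_leftCoset_iff, SetLike.mem_coe, MulAction.mem_stabilizer_iff, mul_smul,
      inv_smul_eq_iff]
    exact (hg _ hp).symm
  obtain ⟨p, hp, hfin⟩ := Subgroup.exists_finiteIndex_of_leftCoset_cover hcov
  have hpR : p.1 ∈ R := hR.mem_toFinset.1 (Finset.mem_product.1 (Finset.mem_filter.1 hp).1).1
  have := Finite.of_equiv _ (MulAction.orbitEquivQuotientStabilizer T p.1).symm
  exact h _ hpR (Set.toFinite _)

/-! ### From categoricity to bounded closure -/

theorem iso_of_categorical {C : Set FinGraph} (hC : IsAlephZeroCategorical (theoryStar C))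
    {V V' : Type} {G : SimpleGraph V} {G' : SimpleGraph V'} (hG : IsExistentiallyComplete C G)
    (hG' : IsExistentiallyComplete C G') : Nonempty (G ≃g G') := by
  let := G.structure
  let := G'.structure
  obtain ⟨e⟩ := hC.2 V V' hG.1.1 hG'.1.1 (model_theoryStar hG) (model_theoryStar hG')
  refine ⟨⟨e.toEquiv, fun {x y} => ?_⟩⟩
  exact e.map_rel adj ![x, y]

theorem exists_isExistentiallyComplete_of_categorical {C : Set FinGraph}
    (hC : IsAlephZeroCategorical (theoryStar C)) :
    ∃ (V : Type) (G : SimpleGraph V), IsExistentiallyComplete C G := by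
  obtain ⟨V, S, hcount, hV⟩ := hC.1
  obtain ⟨G, rfl⟩ := exists_simpleGraph_of_model (model_simpleGraph_of_theoryStar hV)
  obtain ⟨W, H, hH, -⟩ := exists_isExistentiallyComplete ⟨hcount, omits_of_model_theoryStar hV⟩
  exact ⟨W, H, hH⟩

/-- A non-isolated type would be omitted by some existentially complete graph, but that graph is
isomorphic to `G`, which realizes it. -/
theorem typesIsolated_of_categorical {C : Set FinGraph}
    (hC : IsAlephZeroCategorical (theoryStar C)) : TypesIsolated C := by
  intro n V G a hG
  by_contra! hcon
  have hempty : Omits C (⊥ : SimpleGraph Empty) := hG.1.2.of_embedding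
    (H := G) ⟨⟨Empty.elim, fun x => x.elim⟩, fun {x} => x.elim⟩
  obtain ⟨W, H, hH, hHa⟩ := exists_omitting hempty (exType G a) (by
    intro φ hφ
    obtain ⟨V', G', a', hG', hφ', hne⟩ := hcon φ hφ
    refine ⟨V', G', a', hG'.1.2, hφ', ?_⟩
    -- Maximality upgrades a mere difference of types to a pattern at `a'` outside the type of `a`,
    -- as omitting types requires.
    by_contra! hsub
    refine hne (hG'.exType_eq_of_subset hG.1.2 fun ψ hψ => ?_)
    by_contra h
    exact hsub ψ h hψ)
  obtain ⟨σ⟩ := iso_of_categorical hC hG hH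
  exact hHa _ (exType_map_iso σ a)

/-- A countable elementary substructure through finitely many points. -/
theorem exists_countable_elementaryEmbedding (M : Type) [Language.graph.Structure M]
    {s : Set M} (hs : s.Finite) : ∃ (N : Type) (_ : Language.graph.Structure N)
      (ι : N ↪ₑ[Language.graph] M), Countable N ∧ s ⊆ Set.range ι := by
  by_cases hM : Countable M
  · exact ⟨M, inferInstance, ElementaryEmbedding.refl _ _, hM, fun x _ => ⟨x, rfl⟩⟩
  · have : ∀ l, Countable (Language.graph.Functions l) := fun l =>
      inferInstanceAs (Countable Empty)
    have hL : Language.graph.card ≤ Cardinal.aleph0 :=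
      Cardinal.mk_le_aleph0_iff.2 (inferInstanceAs (Countable (_ ⊕ _)))
    have hM' : Cardinal.aleph0 ≤ Cardinal.mk M :=
      (lt_of_not_ge fun h => hM (Cardinal.mk_le_aleph0_iff.1 h)).le
    obtain ⟨N, hsN, hN⟩ := exists_elementarySubstructure_card_eq Language.graph s
      Cardinal.aleph0.{0}
      le_rfl (by simpa using hs.countable) (by simpa using hL) (by simpa using hM')
    refine ⟨N, inferInstance, N.subtype, ?_, fun x hx => ⟨⟨x, hsN hx⟩, rfl⟩⟩
    rw [← Cardinal.mk_le_aleph0_iff]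
    simpa using hN.le

/-- Given tuples of infinitely many distinct types, a nonprincipal ultraproduct contains a limit
tuple. A countable elementary submodel around it is isomorphic to `G`, so a pattern isolates the
type of the limit. By Łoś that pattern holds at almost all the tuples, though it can hold at no more
than one. -/
theorem finite_types_of_categorical {C : Set FinGraph}
    (hC : IsAlephZeroCategorical (theoryStar C)) {V : Type} {G : SimpleGraph V}
    (hG : IsExistentiallyComplete C G) (n : ℕ) :
    (Set.range fun a : Fin n → V => exType G a).Finite := by
  by_contra hinf
  rcases isEmpty_or_nonempty V with hV | hV
  · exact hinf (Set.finite_range _)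
  have hinf : (Set.range fun a : Fin n → V => exType G a).Infinite := hinf
  let p := hinf.natEmbedding
  choose a ha using fun k => (p k).2
  let := G.structure
  let u : Ultrafilter ℕ := hyperfilter ℕ
  let M := (u : Filter ℕ).Product (fun _ => V)
  let mk : (ℕ → V) → M := fun x => (x : (u : Filter ℕ).Product fun _ => V)
  have hM : M ⊨ theoryStar C := ⟨fun φ hφ =>
    (Ultraproduct.sentence_realize φ).2 (Eventually.of_forall fun _ => hφ V G hG)⟩
  let c : Fin n → M := fun i => mk fun k => a k i
  obtain ⟨N, _, ι, hN, hc⟩ := exists_countable_elementaryEmbedding M (Set.finite_range c)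
  obtain ⟨e⟩ := hC.2 N V hN hG.1.1 ((ι.theory_model_iff _).2 hM) (model_theoryStar hG)
  choose d hd using fun i => hc ⟨i, rfl⟩
  obtain ⟨φ, hφ, hφ'⟩ := typesIsolated_of_categorical hC n V G (e ∘ d) hG
  rw [← φ.realize_formula, StrongHomClass.realize_formula, ← ι.map_formula] at hφ
  have hφc : φ.formula.Realize c := by
    convert hφ using 1
    exact funext fun i => (hd i).symm
  have hev : ∀ᶠ k in u, φ.formula.Realize fun i => a k i :=
    (Ultraproduct.realize_formula_cast (M := fun _ : ℕ => V) (u := u) φ.formula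
      (fun i k => a k i)).1 hφc
  have hsub : {k | φ.formula.Realize fun i => a k i}.Subsingleton := by
    intro k hk l hl
    rw [Set.mem_ofPred_eq, φ.realize_formula] at hk hl
    refine p.injective (Subtype.ext ?_)
    rw [← ha k, ← ha l]
    exact (hφ' V G _ hG hk).trans (hφ' V G _ hG hl).symm
  exact notMem_hyperfilter_of_finite hsub.finite hev

section Homogeneous

variable {C : Set FinGraph} {V : Type} {G : SimpleGraph V}

theorem exists_iso_fixing (hC : TypesIsolated C) (hG : IsExistentiallyComplete C G) {n : ℕ}
    {a : Fin n → V} {x y : V}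
    (h : exType G (Fin.snoc a x : Fin (n + 1) → V) = exType G (Fin.snoc a y : Fin (n + 1) → V)) :
    ∃ σ : G ≃g G, (∀ i, σ (a i) = a i) ∧ σ x = y := by
  obtain ⟨σ, hσ⟩ := hC.exists_iso hG hG h
  exact ⟨σ, fun i => by simpa using hσ i.castSucc, by simpa using hσ (Fin.last n)⟩

theorem exType_snoc_eq_of_iso {n : ℕ} {a : Fin n → V} (σ : G ≃g G) (hσ : ∀ i, σ (a i) = a i)
    (x : V) : exType G (Fin.snoc a (σ x) : Fin (n + 1) → V) =
      exType G (Fin.snoc a x : Fin (n + 1) → V) := by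
  rw [← exType_map_iso σ (Fin.snoc a x)]
  congr 1
  ext i
  induction i using Fin.lastCases with
  | last => simp
  | cast i => simp [hσ]

/-- The elements of the same existential type as `x` over `a`. -/
def conjugates (G : SimpleGraph V) {n : ℕ} (a : Fin n → V) (x : V) : Set V :=
  {y | exType G (Fin.snoc a y : Fin (n + 1) → V) = exType G (Fin.snoc a x : Fin (n + 1) → V)}

/-- The elements with finitely many conjugates over `a`. -/
def algClosure (G : SimpleGraph V) {n : ℕ} (a : Fin n → V) : Set V :=
  {x | (conjugates G a x).Finite}

/-- The closure is the union of the finite fibres of a map with finitely many values, sending `y` to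
the type of `(a, y)`. -/
theorem finite_algClosure {n : ℕ} (a : Fin n → V)
    (hfin : (Set.range fun b : Fin (n + 1) → V => exType G b).Finite) :
    (algClosure G a).Finite := by
  let fib : Set (Pattern (n + 1)) → Set V := fun p =>
    {y | exType G (Fin.snoc a y : Fin (n + 1) → V) = p}
  have : (⋃ p ∈ {p ∈ Set.range fun b : Fin (n + 1) → V => exType G b | (fib p).Finite},
      fib p).Finite :=
    (hfin.subset (Set.sep_subset _ _)).biUnion fun p hp => hp.2
  exact this.subset fun x hx => Set.mem_biUnion ⟨⟨Fin.snoc a x, rfl⟩, hx⟩ rfl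

theorem mem_algClosure {n : ℕ} (a : Fin n → V) (i : Fin n) : a i ∈ algClosure G a := by
  refine (Set.finite_singleton (a i)).subset fun y hy => ?_
  have := (eq_and_adj_iff_of_exType_subset (Eq.subset hy) (Fin.last n) i.castSucc).1
  simpa using this

theorem map_mem_algClosure {n : ℕ} {a : Fin n → V} (σ : G ≃g G) (hσ : ∀ i, σ (a i) = a i)
    {x : V} (hx : x ∈ algClosure G a) : σ x ∈ algClosure G a := by
  change (conjugates G a (σ x)).Finite
  rw [conjugates, exType_snoc_eq_of_iso σ hσ]
  exact hx

/-- Each of the infinitely many conjugates of `x` over `a` is the image of `x` under an automorphism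
fixing `a`, which maps the finite closure into itself. By pigeonhole infinitely many of these agree
on the closure; composing them with the inverse of one gives automorphisms that fix it pointwise and
send `x` to distinct points. -/
theorem infinite_conjugates (hC : TypesIsolated C) (hG : IsExistentiallyComplete C G) {n m : ℕ}
    {a : Fin n → V} {b : Fin m → V} (hb : Set.range b = algClosure G a)
    {x : V} (hx : x ∉ algClosure G a) : (conjugates G b x).Infinite := by
  have hinf : (conjugates G a x).Infinite := hx
  have hσ : ∀ y : conjugates G a x, ∃ σ : G ≃g G, (∀ i, σ (a i) = a i) ∧ σ x = y :=
    fun y => exists_iso_fixing hC hG y.2.symm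
  choose σ hσa hσx using hσ
  have := hinf.to_subtype
  have : Finite (algClosure G a) := by
    rw [← hb]
    infer_instance
  let F : conjugates G a x → Fin m → algClosure G a := fun y i =>
    ⟨σ y (b i), map_mem_algClosure (σ y) (hσa y) (hb ▸ ⟨i, rfl⟩)⟩
  obtain ⟨h, hh⟩ := Finite.exists_infinite_fiber F
  obtain ⟨y₀, hy₀⟩ := (Set.infinite_coe_iff.1 hh).nonempty
  refine ((Set.infinite_coe_iff.1 hh).image (f := fun y => (σ y₀).symm y.1) ?_).mono ?_
  · intro y _ z _ hyz
    exact Subtype.ext ((σ y₀).symm.injective hyz)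
  · rintro _ ⟨y, hy, rfl⟩
    have hfix : ∀ i, (σ y₀).symm (σ y (b i)) = b i := by
      intro i
      have h1 : F y i = F y₀ i := congrFun ((show F y = h from hy).trans hy₀.symm) i
      have h2 : σ y (b i) = σ y₀ (b i) := congrArg Subtype.val h1
      rw [h2]
      simp
    have := exType_snoc_eq_of_iso ((σ y).trans (σ y₀).symm) hfix x
    change exType G (Fin.snoc b ((σ y₀).symm (σ y x)) : Fin (m + 1) → V) = _ at this
    rw [hσx] at this
    exact this

theorem omits_double_algClosure (hC : TypesIsolated C) (hG : IsExistentiallyComplete C G) {n : ℕ}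
    (a : Fin n → V) (hfin : (algClosure G a).Finite) :
    Omits C (double G (algClosure G a)) := by
  refine omits_double_of_moving hG.1.2 fun S R hS hR hRB => ?_
  have := hfin.to_subtype
  let e := (Finite.equivFin (algClosure G a)).symm
  let b : Fin (Nat.card (algClosure G a)) → V := fun i => e i
  have hb : Set.range b = algClosure G a := by
    ext x
    constructor
    · rintro ⟨i, rfl⟩
      exact (e i).2
    · intro hx
      exact ⟨e.symm ⟨x, hx⟩, congrArg Subtype.val (e.apply_symm_apply ⟨x, hx⟩)⟩
  let T : Subgroup (G ≃g G) := fixingSubgroup (G ≃g G) (Set.range b)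
  have hT : ∀ σ : G ≃g G, σ ∈ T ↔ ∀ i, σ (b i) = b i := by
    intro σ
    rw [mem_fixingSubgroup_iff]
    simp only [Set.forall_mem_range]
    rfl
  obtain ⟨σ, hσ⟩ := exists_smul_notMem_of_infinite_orbits (T := T) hS hR (by
    intro x hx
    refine (infinite_conjugates hC hG hb (Set.disjoint_left.1 hRB hx)).mono fun y hy => ?_
    obtain ⟨σ, hσb, hσx⟩ := exists_iso_fixing hC hG (Eq.symm hy)
    exact ⟨⟨σ, (hT σ).2 hσb⟩, hσx⟩)
  refine ⟨σ.1, fun x hx => ?_, hσ⟩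
  rw [← hb] at hx
  obtain ⟨i, rfl⟩ := hx
  exact (hT _).1 σ.2 i

end Homogeneous

/-- Automorphisms carry closures to closures, so one bound per type suffices, and there are finitely
many types. -/
theorem hasBoundedClosure_of_categorical {C : Set FinGraph}
    (hC : IsAlephZeroCategorical (theoryStar C)) : HasBoundedClosure C := by
  obtain ⟨V, G, hG⟩ := exists_isExistentiallyComplete_of_categorical hC
  have hiso := typesIsolated_of_categorical hC
  have hfin := finite_types_of_categorical hC hG
  have hbound : ∀ n, ∃ N, ∀ a : Fin n → V, ∃ B : Set V, B.Finite ∧ Set.range a ⊆ B ∧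
      B.ncard ≤ N ∧ Omits C (double G B) := by
    intro n
    have hp : ∀ p ∈ Set.range fun a : Fin n → V => exType G a, ∃ k, ∀ a : Fin n → V,
        exType G a = p → ∃ B : Set V, B.Finite ∧ Set.range a ⊆ B ∧
          B.ncard ≤ k ∧ Omits C (double G B) := by
      rintro _ ⟨a₀, rfl⟩
      have hcl := finite_algClosure a₀ (hfin (n + 1))
      refine ⟨(algClosure G a₀).ncard, fun a ha => ?_⟩
      obtain ⟨σ, hσ⟩ := hiso.exists_iso hG hG ha
      refine ⟨σ.toEmbedding ⁻¹' algClosure G a₀, hcl.preimage σ.injective.injOn, ?_, ?_,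
        (omits_double_algClosure hiso hG a₀ hcl).of_embedding (doubleEmbedding _ _)⟩
      · rintro _ ⟨i, rfl⟩
        change σ (a i) ∈ algClosure G a₀
        rw [hσ]
        exact mem_algClosure a₀ i
      · exact Set.ncard_le_ncard_of_injOn σ (fun x hx => hx) σ.injective.injOn hcl
    choose! k hk using hp
    obtain ⟨N, hN⟩ := ((hfin n).image k).bddAbove
    refine ⟨N, fun a => ?_⟩
    obtain ⟨B, h1, h2, h3, h4⟩ := hk _ ⟨a, rfl⟩ a rfl
    exact ⟨B, h1, h2, h3.trans (hN ⟨_, ⟨a, rfl⟩, rfl⟩), h4⟩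
  choose N hN using hbound
  -- Any countable graph omitting `C` embeds into `G`, and the trace of a set `B` found there
  -- inherits every requirement.
  refine ⟨N, fun W H hH n a => ?_⟩
  obtain ⟨W', H', hH', ⟨f⟩⟩ := exists_isExistentiallyComplete hH
  obtain ⟨σ⟩ := iso_of_categorical hC hH' hG
  let g : H ↪g G := σ.toEmbedding.comp f
  obtain ⟨B, h1, h2, h3, h4⟩ := hN n (g ∘ a)
  refine ⟨g ⁻¹' B, h1.preimage g.injective.injOn, ?_, ?_, h4.of_embedding (doubleEmbedding g B)⟩
  · rintro _ ⟨i, rfl⟩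
    exact h2 ⟨i, rfl⟩
  · exact (Set.ncard_le_ncard_of_injOn g (fun x hx => hx) g.injective.injOn h1).trans h3

/-! ### Adding constraints closed under homomorphic image -/

theorem omits_double_of_isHomClosed {H : Set FinGraph} (hH : IsHomClosed H) {V : Type}
    {G : SimpleGraph V} (hG : Omits H G) (B : Set V) : Omits H (double G B) := by
  rintro K hK ⟨c⟩
  have := K.finite
  -- Forgetting the copy index is a homomorphism from the double to `G`, though usually not
  -- injective on the copy of `K`.
  let φ : K.graph →g G := ⟨fun x => (c x).1.1, fun h => (c.toHom.map_adj h).1⟩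
  -- Only edges that are images of edges of `K` are kept, for surjectivity on edges; there are no
  -- loops because `G` has none.
  let D : SimpleGraph (Set.range φ) :=
    { Adj := fun u v => ∃ x y, K.graph.Adj x y ∧ φ x = u ∧ φ y = v
      symm := ⟨fun u v ⟨x, y, h, hx, hy⟩ => ⟨y, x, h.symm, hy, hx⟩⟩
      loopless := ⟨fun u ⟨x, y, h, hx, hy⟩ => (φ.map_adj h).ne (hx.trans hy.symm)⟩ }
  have hfin : Finite (Set.range φ) := Set.finite_range φ
  obtain ⟨K', hK', ⟨d⟩⟩ := hH K hK ⟨Set.range φ, D⟩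
    ⟨⟨fun x => ⟨φ x, x, rfl⟩, fun {x y} h => ⟨x, y, h, rfl, rfl⟩⟩,
      fun ⟨_, x, hx⟩ => ⟨x, Subtype.ext hx⟩,
      fun u v ⟨x, y, h, hx, hy⟩ => ⟨x, y, h, Subtype.ext hx, Subtype.ext hy⟩⟩
  refine hG K' hK' ⟨⟨⟨fun x => (d x).1, fun h => ?_⟩, fun x y hxy => ?_⟩⟩
  · obtain ⟨x, y, h, hx, hy⟩ := d.toHom.map_adj h
    have := φ.map_adj h
    rw [hx, hy] at this
    exact this
  · exact d.injective (Subtype.ext hxy)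

theorem HasBoundedClosure.union {C H : Set FinGraph} (hC : HasBoundedClosure C)
    (hH : IsHomClosed H) : HasBoundedClosure (C ∪ H) := by
  obtain ⟨f, hf⟩ := hC
  refine ⟨f, fun V G hG n a => ?_⟩
  obtain ⟨B, h1, h2, h3, h4⟩ := hf V G ⟨hG.1, fun K hK => hG.2 K (Or.inl hK)⟩ n a
  refine ⟨B, h1, h2, h3, ?_⟩
  rintro K (hK | hK)
  · exact h4 K hK
  · exact omits_double_of_isHomClosed hH (fun K hK => hG.2 K (Or.inr hK)) B K hK

/-! ### Free amalgams and finiteness of types -/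

theorem isContained_of_range_subset {U V W : Type*} {K : SimpleGraph U} {A : SimpleGraph V}
    {H : SimpleGraph W} (f : A ↪g H) (c : K.Copy H) (h : ∀ x, c x ∈ Set.range f) :
    K.IsContained A := by
  choose e he using h
  refine ⟨⟨⟨e, fun {x y} hxy => ?_⟩, fun x y hxy => c.injective ?_⟩⟩
  · rw [← f.map_adj_iff, he, he]
    exact c.toHom.map_adj hxy
  · have hxy' : e x = e y := hxy
    change c x = c y
    rw [← he, ← he, hxy']

theorem ncard_range_le {α β : Type*} [Finite α] (f : α → β) :
    (Set.range f).ncard ≤ Nat.card α := by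
  rw [← Set.image_univ, ← Set.ncard_univ]
  exact Set.ncard_image_le Set.finite_univ

section Amalgam

variable {V V' : Type} {m : ℕ}

/-- The free amalgam of `G` and `G'` identifying the tuples `b` and `b'`. -/
def freeAmalgam (G : SimpleGraph V) (b : Fin m → V) (G' : SimpleGraph V') (b' : Fin m → V') :
    SimpleGraph (V ⊕ {y : V' // y ∉ Set.range b'}) where
  Adj
    | Sum.inl x, Sum.inl y => G.Adj x y
    | Sum.inl x, Sum.inr y => ∃ i, x = b i ∧ G'.Adj (b' i) y
    | Sum.inr x, Sum.inl y => ∃ i, y = b i ∧ G'.Adj (b' i) x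
    | Sum.inr x, Sum.inr y => G'.Adj x y
  symm := ⟨by
    rintro (x | x) (y | y) h
    · exact SimpleGraph.Adj.symm (G := G) h
    · exact h
    · exact h
    · exact SimpleGraph.Adj.symm (G := G') h⟩
  loopless := ⟨by
    rintro (x | x) h
    · exact G.loopless.irrefl _ h
    · exact G'.loopless.irrefl _ h⟩

variable {G : SimpleGraph V} {b : Fin m → V} {G' : SimpleGraph V'} {b' : Fin m → V'}

/-- The first graph as a subgraph of a free amalgam. -/
def amalgamLeft (G : SimpleGraph V) (b : Fin m → V) (G' : SimpleGraph V') (b' : Fin m → V') :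
    G ↪g freeAmalgam G b G' b' :=
  ⟨⟨Sum.inl, Sum.inl_injective⟩, Iff.rfl⟩

theorem exists_amalgamRight (h : ∀ i j, (b i = b j ↔ b' i = b' j) ∧
    (G.Adj (b i) (b j) ↔ G'.Adj (b' i) (b' j))) :
    ∃ f : G' ↪g freeAmalgam G b G' b', ∀ i, f (b' i) = Sum.inl (b i) := by
  classical
  let t : V' → V ⊕ {y : V' // y ∉ Set.range b'} := fun y =>
    if hy : y ∈ Set.range b' then Sum.inl (b hy.choose) else Sum.inr ⟨y, hy⟩
  have ht : ∀ i, t (b' i) = Sum.inl (b i) := by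
    intro i
    have hi : b' i ∈ Set.range b' := ⟨i, rfl⟩
    change (if hy : b' i ∈ Set.range b' then _ else _) = _
    rw [dif_pos hi]
    exact congrArg _ (((h _ _).1).2 hi.choose_spec)
  have ht' : ∀ y (hy : y ∉ Set.range b'), t y = Sum.inr ⟨y, hy⟩ := fun y hy => dif_neg hy
  refine ⟨⟨⟨t, fun x y hxy => ?_⟩, fun {x y} => ?_⟩, ht⟩
  · by_cases hx : x ∈ Set.range b' <;> by_cases hy : y ∈ Set.range b'
    · obtain ⟨i, rfl⟩ := hx
      obtain ⟨j, rfl⟩ := hy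
      rw [ht, ht] at hxy
      exact (h i j).1.1 (Sum.inl_injective hxy)
    · obtain ⟨i, rfl⟩ := hx
      rw [ht, ht' y hy] at hxy
      cases hxy
    · obtain ⟨j, rfl⟩ := hy
      rw [ht, ht' x hx] at hxy
      cases hxy
    · rw [ht' x hx, ht' y hy] at hxy
      exact Subtype.mk.inj (Sum.inr_injective hxy)
  · change (freeAmalgam G b G' b').Adj (t x) (t y) ↔ _
    have aux : ∀ (i : Fin m) (z : V'), (∃ j, b i = b j ∧ G'.Adj (b' j) z) ↔ G'.Adj (b' i) z := by
      intro i z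
      refine ⟨?_, fun hz => ⟨i, rfl, hz⟩⟩
      rintro ⟨j, hij, hz⟩
      rwa [(h i j).1.1 hij]
    by_cases hx : x ∈ Set.range b' <;> by_cases hy : y ∈ Set.range b'
    · obtain ⟨i, rfl⟩ := hx
      obtain ⟨j, rfl⟩ := hy
      rw [ht, ht]
      exact (h i j).2
    · obtain ⟨i, rfl⟩ := hx
      rw [ht, ht' y hy]
      exact aux i y
    · obtain ⟨j, rfl⟩ := hy
      rw [ht, ht' x hx]
      exact (aux j x).trans (G'.adj_comm _ _)
    · rw [ht' x hx, ht' y hy]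
      exact Iff.rfl

/-- The amalgam maps injectively and homomorphically into the double of `G'`: `G` goes through `g`
into the second copy, apart from the shared points, and the rest of `G'` into the first. -/
theorem omits_freeAmalgam_of_embedding {C : Set FinGraph} (g : G ↪g G') (hg : ∀ i, g (b i) = b' i)
    (h : Omits C (double G' (Set.range b'))) : Omits C (freeAmalgam G b G' b') := by
  classical
  rintro K hK ⟨c⟩
  let F : V ⊕ {y : V' // y ∉ Set.range b'} →
      {p : V' × Bool // p.1 ∈ Set.range b' → p.2 = false} :=
    Sum.elim
      (fun x => ⟨(g x, decide (g x ∉ Set.range b')), fun hx => decide_eq_false (not_not.2 hx)⟩)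
      (fun y => ⟨(y, false), fun _ => rfl⟩)
  have hmixed : ∀ x y, F (Sum.inl x) ≠ F (Sum.inr y) := by
    intro x y hxy
    have hxy' := Subtype.mk.inj hxy
    simp only [Prod.mk.injEq, decide_eq_false_iff_not, not_not] at hxy'
    exact y.2 (hxy'.1 ▸ hxy'.2)
  have hinj : Function.Injective F := by
    rintro (x | x) (y | y) hxy
    · exact congrArg _ (g.injective (congrArg Prod.fst (Subtype.mk.inj hxy)))
    · exact absurd hxy (hmixed x y)
    · exact absurd hxy.symm (hmixed y x)
    · exact congrArg _ (Subtype.ext (congrArg Prod.fst (Subtype.mk.inj hxy)))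
  have hadj : ∀ p q, (freeAmalgam G b G' b').Adj p q →
      (double G' (Set.range b')).Adj (F p) (F q) := by
    rintro (x | x) (y | y) hxy
    · refine ⟨g.map_adj_iff.2 hxy, ?_⟩
      by_cases hx : g x ∈ Set.range b'
      · exact Or.inr (Or.inl hx)
      by_cases hy : g y ∈ Set.range b'
      · exact Or.inr (Or.inr hy)
      · exact Or.inl ((decide_eq_true hx).trans (decide_eq_true hy).symm)
    · obtain ⟨i, rfl, hi⟩ := hxy
      rw [← hg] at hi
      exact ⟨hi, Or.inr (Or.inl ⟨i, (hg i).symm⟩)⟩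
    · obtain ⟨i, rfl, hi⟩ := hxy
      rw [← hg] at hi
      exact ⟨hi.symm, Or.inr (Or.inr ⟨i, (hg i).symm⟩)⟩
    · exact ⟨hxy, Or.inl rfl⟩
  exact h K hK ⟨⟨⟨fun x => F (c x), fun hxy => hadj _ _ (c.toHom.map_adj hxy)⟩,
    fun x y hxy => c.injective (hinj hxy)⟩⟩

/-- A forbidden copy meets `G` in at most `N` vertices; with the `m` points of `b` this gives a
pattern of size at most `m + N`. It recurs in `G'` over `b'`, which reduces to the case where the
left graph embeds. -/
theorem omits_freeAmalgam {C : Set FinGraph} {N : ℕ} (hN : ∀ K ∈ C, Nat.card K.V ≤ N)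
    (hb : ∀ P : Pattern m, P.size ≤ m + N → P.Holds G b → P.Holds G' b')
    (h : Omits C (double G' (Set.range b'))) : Omits C (freeAmalgam G b G' b') := by
  rintro K hK ⟨c⟩
  have := K.finite
  have hfin : (Set.range c).Finite := Set.finite_range c
  let S : Set V := Set.range b ∪ Sum.inl ⁻¹' Set.range c
  have hS' : (Sum.inl ⁻¹' Set.range c : Set V).Finite :=
    hfin.preimage Sum.inl_injective.injOn
  have hS : S.Finite := (Set.finite_range b).union hS'
  have hcard : S.ncard ≤ m + N := by
    refine (Set.ncard_union_le _ _).trans (add_le_add ?_ ?_)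
    · simpa using ncard_range_le b
    · exact (Set.ncard_le_ncard_of_injOn Sum.inl (fun x hx => hx)
        Sum.inl_injective.injOn hfin).trans
        ((ncard_range_le c).trans (hN K hK))
  have hbS : ∀ i, b i ∈ S := fun i => Or.inl ⟨i, rfl⟩
  obtain ⟨P, hPs, hP, hP'⟩ := exists_pattern_of_set G b hS hbS
  obtain ⟨g, hg⟩ := (hP' _ _ _).1 (hb P (hPs ▸ hcard) hP)
  let f : freeAmalgam (G.induce S) (fun i => ⟨b i, hbS i⟩) G' b' ↪g freeAmalgam G b G' b' :=
    { toFun := Sum.map Subtype.val id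
      inj' := Subtype.val_injective.sumMap Function.injective_id
      map_rel_iff' := by
        rintro (x | x) (y | y)
        · exact Iff.rfl
        · exact exists_congr fun i => and_congr_left'
            (Subtype.ext_iff (a2 := ⟨b i, hbS i⟩)).symm
        · exact exists_congr fun i => and_congr_left'
            (Subtype.ext_iff (a2 := ⟨b i, hbS i⟩)).symm
        · exact Iff.rfl }
  refine omits_freeAmalgam_of_embedding g hg h K hK (isContained_of_range_subset f c fun x => ?_)
  rcases hx : c x with y | y
  · exact ⟨Sum.inl ⟨y, Or.inr ⟨x, hx⟩⟩, rfl⟩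
  · exact ⟨Sum.inr y, rfl⟩

theorem eq_and_adj_iff_of_bounded {N : ℕ}
    (hb : ∀ P : Pattern m, P.size ≤ m + N → P.Holds G b → P.Holds G' b') (i j : Fin m) :
    (b i = b j ↔ b' i = b' j) ∧ (G.Adj (b i) (b j) ↔ G'.Adj (b' i) (b' j)) := by
  obtain ⟨P, hPs, hP, hP'⟩ :=
    exists_pattern_of_set G b (Set.finite_range b) (fun i => ⟨i, rfl⟩)
  have hcard : (Set.range b).ncard ≤ m + N :=
    (ncard_range_le b).trans (by simp)
  obtain ⟨g, hg⟩ := (hP' _ _ _).1 (hb P (hPs ▸ hcard) hP)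
  rw [← hg i, ← hg j, g.injective.eq_iff, g.map_adj_iff]
  exact ⟨⟨fun h => Subtype.ext h, fun h => Subtype.mk.inj h⟩, Iff.rfl⟩

end Amalgam

theorem finite_types_of_hasBoundedClosure {C : Set FinGraph} (hfin : C.Finite)
    (hC : HasBoundedClosure C) (n : ℕ) :
    {p : Set (Pattern n) | ∃ (V : Type) (G : SimpleGraph V) (a : Fin n → V),
      IsExistentiallyComplete C G ∧ exType G a = p}.Finite := by
  obtain ⟨f, hf⟩ := hC
  obtain ⟨N, hN⟩ : ∃ N, ∀ K ∈ C, Nat.card K.V ≤ N := by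
    obtain ⟨N, hN⟩ := (hfin.image fun K => Nat.card K.V).bddAbove
    exact ⟨N, fun K hK => hN ⟨K, hK, rfl⟩⟩
  -- The finite datum of a tuple: the size of its closure, the position of the tuple in an
  -- enumeration of it, and the patterns of size at most `m + N` at that enumeration.
  let D := Σ m : Fin (f n + 1), (Fin n → Fin m) × Set {P : Pattern m // P.size ≤ m + N}
  have : ∀ m : ℕ, Finite {P : Pattern m // P.size ≤ m + N} := fun m =>
    Pattern.finite_size_le m (m + N)
  have hdata : ∀ p : {p : Set (Pattern n) | ∃ (V : Type) (G : SimpleGraph V) (a : Fin n → V),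
      IsExistentiallyComplete C G ∧ exType G a = p}, ∃ d : D,
      ∃ (V : Type) (G : SimpleGraph V) (b : Fin d.1 → V), IsExistentiallyComplete C G ∧
        exType G (b ∘ d.2.1) = p ∧ Omits C (double G (Set.range b)) ∧
        ∀ P, P ∈ d.2.2 ↔ P.1.Holds G b := by
    rintro ⟨_, V, G, a, hG, rfl⟩
    obtain ⟨B, hB, haB, hBn, hdouble⟩ := hf V G hG.1 n a
    have := hB.to_subtype
    let e := (Finite.equivFin B).symm
    have hlt : Nat.card B < f n + 1 := Nat.lt_succ_of_le hBn
    have hrange : Set.range (fun i => (e i : V)) = B := by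
      ext x
      constructor
      · rintro ⟨i, rfl⟩
        exact (e i).2
      · intro hx
        exact ⟨e.symm ⟨x, hx⟩, congrArg Subtype.val (e.apply_symm_apply ⟨x, hx⟩)⟩
    refine ⟨⟨⟨Nat.card B, hlt⟩, fun i => e.symm ⟨a i, haB ⟨i, rfl⟩⟩,
      {P | P.1.Holds G fun i => (e i : V)}⟩, V, G, fun i => e i, hG, ?_, ?_, fun P => Iff.rfl⟩
    · congr 1
      funext i
      exact congrArg Subtype.val (e.apply_symm_apply ⟨a i, _⟩)
    · rw [hrange]
      exact hdouble
  choose d hd using hdata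
  -- Equal data allow free amalgamation over the enumerated closures. Both types are unchanged in
  -- the amalgam, where the two tuples coincide.
  have hinj : Function.Injective d := by
    intro p q hpq
    obtain ⟨V, G, b, hG, hp, -, hP⟩ := hd p
    have hd' := hd q
    rw [← hpq] at hd'
    obtain ⟨V', G', b', hG', hq, hdouble, hP'⟩ := hd'
    have hb : ∀ P : Pattern (d p).1, P.size ≤ (d p).1 + N → P.Holds G b → P.Holds G' b' :=
      fun P hPs h => (hP' ⟨P, hPs⟩).1 ((hP ⟨P, hPs⟩).2 h)
    obtain ⟨r, hr⟩ := exists_amalgamRight (eq_and_adj_iff_of_bounded hb)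
    have := hG.1.1
    have := hG'.1.1
    have hW : IsCountableFree C (freeAmalgam G b G' b') :=
      ⟨inferInstance, omits_freeAmalgam hN hb hdouble⟩
    apply Subtype.ext
    rw [← hp, ← hq, ← hG.exType_eq hW (amalgamLeft G b G' b'), ← hG'.exType_eq hW r]
    congr 1
    funext i
    exact (hr _).symm
  have := Finite.of_injective d hinj
  exact Set.toFinite _

/-! ### Joint embedding and categoricity -/

theorem omits_sum {C : Set FinGraph} (hC : ∀ K ∈ C, K.graph.Connected) {V V' : Type}
    {G : SimpleGraph V} {G' : SimpleGraph V'} (hG : Omits C G) (hG' : Omits C G') :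
    Omits C (G ⊕g G') := by
  rintro K hK ⟨c⟩
  have hside : ∀ x y, (c x).isLeft = (c y).isLeft := by
    intro x y
    obtain ⟨w⟩ := (hC K hK).preconnected x y
    induction w with
    | nil => rfl
    | @cons u v _ h _ ih =>
      rw [← ih]
      have := c.toHom.map_adj h
      change (G ⊕g G').Adj (c u) (c v) at this
      rcases hu : c u with u' | u' <;> rcases hv : c v with v' | v' <;> simp_all
  obtain ⟨x₀⟩ := (hC K hK).nonempty
  cases h₀ : (c x₀).isLeft
  · refine hG' K hK (isContained_of_range_subset SimpleGraph.Embedding.sumInr c fun x => ?_)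
    have := (hside x x₀).trans h₀
    rcases hx : c x with y | y
    · rw [hx] at this
      cases this
    · exact ⟨y, rfl⟩
  · refine hG K hK (isContained_of_range_subset SimpleGraph.Embedding.sumInl c fun x => ?_)
    have := (hside x x₀).trans h₀
    rcases hx : c x with y | y
    · exact ⟨y, rfl⟩
    · rw [hx] at this
      cases this

/-- Both graphs keep their types in their disjoint sum. This starts the back and forth at the empty
tuple. -/
theorem exType_elim0_eq {C : Set FinGraph} (hC : ∀ K ∈ C, K.graph.Connected) {V V' : Type}
    {G : SimpleGraph V} {G' : SimpleGraph V'} (hG : IsExistentiallyComplete C G)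
    (hG' : IsExistentiallyComplete C G') :
    exType G (Fin.elim0 : Fin 0 → V) = exType G' (Fin.elim0 : Fin 0 → V') := by
  have := hG.1.1
  have := hG'.1.1
  have hfree : IsCountableFree C (G ⊕g G') := ⟨inferInstance, omits_sum hC hG.1.2 hG'.1.2⟩
  rw [← hG.exType_eq hfree SimpleGraph.Embedding.sumInl,
    ← hG'.exType_eq hfree SimpleGraph.Embedding.sumInr]
  congr 1
  exact Subsingleton.elim _ _

/-- With finitely many types, the theory says that every tuple satisfies one of finitely many
isolating patterns, and that each such pattern implies every pattern of its type. -/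
theorem isExistentiallyComplete_of_model {C : Set FinGraph}
    (hfin : ∀ n, {p : Set (Pattern n) | ∃ (V : Type) (G : SimpleGraph V) (a : Fin n → V),
      IsExistentiallyComplete C G ∧ exType G a = p}.Finite)
    {V : Type} [Countable V] {G : SimpleGraph V} (hV : let := G.structure; V ⊨ theoryStar C) :
    IsExistentiallyComplete C G := by
  refine ⟨⟨inferInstance, omits_of_model_theoryStar hV⟩, fun W H hH f => ?_⟩
  rw [isExistentiallyCompleteIn_iff]
  intro n a P hP
  let 𝒯 := {p : Set (Pattern n) | ∃ (V : Type) (G : SimpleGraph V) (a : Fin n → V),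
      IsExistentiallyComplete C G ∧ exType G a = p}
  have : Finite 𝒯 := hfin n
  have hiso : ∀ p : 𝒯, ∃ φ : Pattern n, φ ∈ p.1 ∧
      ∀ (V' : Type) (G' : SimpleGraph V') (a' : Fin n → V'),
        IsExistentiallyComplete C G' → φ.Holds G' a' → exType G' a' = p := by
    rintro ⟨_, V₀, G₀, a₀, hG₀, rfl⟩
    exact typesIsolated_of_finite hfin n V₀ G₀ a₀ hG₀
  choose φ hφ hφ' using hiso
  let := G.structure
  have hcover := realize_of_model_theoryStar hV (Formula.iSup fun p => (φ p).formula)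
    (fun V' G' hG' a' => by
      let := G'.structure
      rw [Formula.realize_iSup]
      refine ⟨⟨_, V', G', a', hG', rfl⟩, ?_⟩
      rw [Pattern.realize_formula]
      exact hφ ⟨_, V', G', a', hG', rfl⟩) a
  rw [Formula.realize_iSup] at hcover
  obtain ⟨p, hp⟩ := hcover
  have himp := realize_of_model_theoryStar hV ((φ p).formula.imp P.formula)
    (fun V' G' hG' a' => by
      let := G'.structure
      rw [Formula.realize_imp, Pattern.realize_formula, Pattern.realize_formula]
      intro h
      -- In an existentially complete extension of `H` the image of `a` still satisfies `φ p`, so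
      -- its type is `p`; since `P` holds there, `P` belongs to `p`.
      obtain ⟨W', H', hH', ⟨g⟩⟩ := exists_isExistentiallyComplete hH
      have hφH := ((((φ p).realize_formula G a).1 hp).map f).map g
      change P ∈ exType G' a'
      rw [hφ' p V' G' a' hG' h, ← hφ' p W' H' _ hH' hφH]
      exact hP.map g) a
  rw [Formula.realize_imp] at himp
  exact (P.realize_formula G a).1 (himp hp)

/-- For finitely many connected forbidden graphs, bounded closures imply categoricity and the
existence of a universal graph. -/
theorem HasBoundedClosure.categorical_and_universal {C : Set FinGraph} (hfin : C.Finite)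
    (hconn : ∀ K ∈ C, K.graph.Connected) (hC : HasBoundedClosure C) :
    IsAlephZeroCategorical (theoryStar C) ∧
      ∃ (V : Type) (G : SimpleGraph V), IsUniversal C G := by
  have htypes := finite_types_of_hasBoundedClosure hfin hC
  have hunique : ∀ {V V' : Type} {G : SimpleGraph V} {G' : SimpleGraph V'},
      IsExistentiallyComplete C G → IsExistentiallyComplete C G' → Nonempty (G ≃g G') := by
    intro V V' G G' hG hG'
    obtain ⟨σ, -⟩ := (typesIsolated_of_finite htypes).exists_iso hG hG'
      (exType_elim0_eq hconn hG hG')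
    exact ⟨σ⟩
  -- Connected graphs are nonempty, so the empty graph omits `C` and the generic construction can
  -- start from it.
  have hempty : IsCountableFree C (⊥ : SimpleGraph Empty) := by
    refine ⟨inferInstance, ?_⟩
    rintro K hK ⟨c⟩
    obtain ⟨x⟩ := (hconn K hK).nonempty
    exact (c x).elim
  obtain ⟨M, G, hG, -⟩ := exists_isExistentiallyComplete hempty
  refine ⟨⟨⟨M, G.structure, hG.1.1, model_theoryStar hG⟩, ?_⟩, M, G, hG.1, ?_⟩
  · intro V W _ _ _ _ hV hW
    obtain ⟨G₁, rfl⟩ := exists_simpleGraph_of_model (model_simpleGraph_of_theoryStar hV)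
    obtain ⟨G₂, rfl⟩ := exists_simpleGraph_of_model (model_simpleGraph_of_theoryStar hW)
    obtain ⟨σ⟩ := hunique (isExistentiallyComplete_of_model htypes hV)
      (isExistentiallyComplete_of_model htypes hW)
    let := G₁.structure
    let := G₂.structure
    refine ⟨⟨σ.toEquiv, fun {n} g => isEmptyElim g, fun {n} r x => ?_⟩⟩
    cases r
    exact σ.map_adj_iff
  · intro W H hH
    obtain ⟨W', H', hH', ⟨f⟩⟩ := exists_isExistentiallyComplete hH
    obtain ⟨σ⟩ := hunique hH' hG
    exact ⟨σ.toEmbedding.comp f⟩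

end ForbiddenGraphs

theorem theorem5 (C H : Set FinGraph)
    (hCfin : C.Finite) (hCconn : ∀ K ∈ C, K.graph.Connected)
    (hCcat : IsAlephZeroCategorical (theoryStar C))
    (hHfin : H.Finite) (hHconn : ∀ K ∈ H, K.graph.Connected)
    (hHhom : IsHomClosed H) :
    IsAlephZeroCategorical (theoryStar (C ∪ H)) ∧
      ∃ (V : Type) (G : SimpleGraph V), IsUniversal (C ∪ H) G :=
  ((hasBoundedClosure_of_categorical hCcat).union hHhom).categorical_and_universal
    (hCfin.union hHfin) (fun K hK => hK.elim (hCconn K) (hHconn K))
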